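/- Let $V$ be a finite-dimensional complex vector space, $G\subset \mathrm{GL}(V)$ a finite subgroup, and $R=\{r\in G : \operatorname{codim}\ker(r-1)=1\}$ its set of reflections. Let $c_r\in\mathbb{C}$ $(r\in R)$ be numbers with $c_{grg^{-1}}=c_r$ for all $g\in G$, $r\in R$, and for $r\in R$ let $\alpha_r\in V^*$ be a linear form with kernel $\ker(r-1)$. The rational Cherednik algebra $H_c=H_c(G,V)$ is the subalgebra of $\mathrm{End}_{\mathbb{C}}(\mathbb{C}[V])$ generated by $\mathbb{C}[V]$ (acting by multiplication), by $G$ (acting by $(gf)(v)=f(g^{-1}v)$), and by the Dunkl operators $$f\mapsto \partial_y f-\sum_{r\in R}c_r\,\langle\alpha_r,y\rangle\,\frac{f-r(f)}{\alpha_r},\qquad y\in V.$$ For an irreducible complex representation $S^\lambda$ of $G$, let $c_\lambda$ be the scalar by which $\sum_{r\in R}c_r(1-r)$ acts on $S^\lambda$, let $\Delta_c(\lambda)$ be the $H_c$-module induced from $S^\lambda$, regarded as a module over the subalgebra generated by $G$ and the Dunkl operators on which the Dunkl operators act by $0$, and let $L_c(\lambda)=\Delta_c(\lambda)/\mathrm{Rad}(\Delta_c(\lambda))$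 be its irreducible quotient. If $L_c(\lambda)$ is finite dimensional, then for every nonzero $v\in V$, with stabilizer $G_S=\{g\in G : gv=v\}$ (where $S=\mathbb{C}^\times v$), the restriction $\mathrm{Res}^G_{G_S}S^\lambda$ belongs to the Serre subcategory of the category of finitely generated $\mathbb{C}G_S$-modules generated by the modules $\mathrm{Res}^G_{G_S}S^\mu$, where $S^\mu$ runs over the irreducible representations of $G$ with $c_\mu-c_\lambda\in\mathbb{Z}_{>0}$. -/

import Mathlib

open CategoryTheory TensorProduct

noncomputable section

namespace Cherednik

section Polynomials

variable {V : Type*} [AddCommGroup V] [Module ℂ V]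

/-- The algebra `ℂ[V] = Sym(V*)` of polynomial functions on `V`. -/
def Poly (V : Type*) [AddCommGroup V] [Module ℂ V] : Type _ :=
  SymmetricAlgebra ℂ (Module.Dual ℂ V)

instance : CommRing (Poly V) := inferInstanceAs (CommRing (SymmetricAlgebra ℂ (Module.Dual ℂ V)))

instance : Algebra ℂ (Poly V) :=
  inferInstanceAs (Algebra ℂ (SymmetricAlgebra ℂ (Module.Dual ℂ V)))

instance : IsDomain (Poly V) :=
  inferInstanceAs (IsDomain (SymmetricAlgebra ℂ (Module.Dual ℂ V)))

/-- Linear forms, regarded as polynomial functions. -/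
def coord : Module.Dual ℂ V →ₗ[ℂ] Poly V := SymmetricAlgebra.ι ℂ (Module.Dual ℂ V)

/-- The algebra map out of `ℂ[V]` with prescribed values on linear forms. -/
def polyLift {A : Type*} [CommRing A] [Algebra ℂ A] (φ : Module.Dual ℂ V →ₗ[ℂ] A) :
    Poly V →ₐ[ℂ] A :=
  SymmetricAlgebra.lift φ

@[simp]
theorem polyLift_coord {A : Type*} [CommRing A] [Algebra ℂ A] (φ : Module.Dual ℂ V →ₗ[ℂ] A)
    (x : Module.Dual ℂ V) : polyLift φ (coord x) = φ x :=
  SymmetricAlgebra.lift_ι_apply φ x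

theorem poly_hom_ext {A : Type*} [CommRing A] [Algebra ℂ A] {φ ψ : Poly V →ₐ[ℂ] A}
    (h : ∀ x, φ (coord x) = ψ (coord x)) : φ = ψ :=
  SymmetricAlgebra.algHom_ext (LinearMap.ext h)

theorem poly_induction {motive : Poly V → Prop}
    (algebraMap : ∀ z, motive (algebraMap ℂ (Poly V) z)) (coord : ∀ x, motive (coord x))
    (mul : ∀ a b, motive a → motive b → motive (a * b))
    (add : ∀ a b, motive a → motive b → motive (a + b)) (f : Poly V) : motive f :=
  SymmetricAlgebra.induction _ _ (motive := motive) algebraMap coord mul add f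

/-- The action of `GL(V)` on `ℂ[V]`, `(g f)(v) = f (g⁻¹ v)`: the algebra map that extends
`x ↦ x ∘ g⁻¹` on linear forms. -/
def polyAct (g : V ≃ₗ[ℂ] V) : Poly V →ₐ[ℂ] Poly V :=
  polyLift
    (coord ∘ₗ LinearMap.dualMap (g⁻¹ : V ≃ₗ[ℂ] V).toLinearMap)

/-- The algebra map `f ↦ f + ε ∂_y f` into the dual numbers over `ℂ[V]`, which sends a linear
form `x` to `x + ε x(y)`. -/
def taylor (y : V) : Poly V →ₐ[ℂ] TrivSqZeroExt (Poly V) (Poly V) :=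
  polyLift
    (((TrivSqZeroExt.inlAlgHom ℂ (Poly V) (Poly V)).toLinearMap ∘ₗ coord) +
        ((TrivSqZeroExt.inrHom (Poly V) (Poly V)).restrictScalars ℂ ∘ₗ
          Algebra.linearMap ℂ (Poly V) ∘ₗ Module.Dual.eval ℂ V y))

/-- The directional derivative `∂_y` on `ℂ[V]`. -/
def pderiv (y : V) : Module.End ℂ (Poly V) :=
  (TrivSqZeroExt.sndHom (Poly V) (Poly V)).restrictScalars ℂ ∘ₗ (taylor y).toLinearMap

theorem pderiv_coord (y : V) (x : Module.Dual ℂ V) :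
    pderiv y (coord x) = algebraMap ℂ (Poly V) (x y) := by
  simp [pderiv, taylor, Algebra.algebraMap_eq_smul_one]

theorem pderiv_mul (y : V) (f h : Poly V) :
    pderiv y (f * h) = f * pderiv y h + pderiv y f * h := by
  have key : (TrivSqZeroExt.fstHom ℂ (Poly V) (Poly V)).comp (taylor y) = AlgHom.id ℂ _ := by
    apply poly_hom_ext
    intro x
    simp [taylor]
  have h1 : ∀ f, (taylor y f).fst = f := fun f => by
    simpa using DFunLike.congr_fun key f
  simp [pderiv, h1, mul_comm]

/-- The fixed space of `g` on `V`. -/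
def fixedSpace (g : V ≃ₗ[ℂ] V) : Submodule ℂ V :=
  LinearMap.ker (g.toLinearMap - LinearMap.id)

/-- A reflection: the fixed space has codimension exactly one. -/
def IsReflection (g : V ≃ₗ[ℂ] V) : Prop :=
  Module.finrank ℂ (V ⧸ fixedSpace g) = 1

theorem exists_form {g : V ≃ₗ[ℂ] V} (hg : IsReflection g) :
    ∃ α : Module.Dual ℂ V, LinearMap.ker α = fixedSpace g := by
  have : Module.Finite ℂ (V ⧸ fixedSpace g) :=
    Module.finite_of_finrank_pos (by rw [hg]; exact one_pos)
  let e : (V ⧸ fixedSpace g) ≃ₗ[ℂ] ℂ :=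
    LinearEquiv.ofFinrankEq _ _ (by rw [hg]; simp)
  exact ⟨e.toLinearMap ∘ₗ (fixedSpace g).mkQ, by simp [LinearMap.ker_comp]⟩

end Polynomials

section Data

variable {V : Type*} [AddCommGroup V] [Module ℂ V]

/-- The set `R` of reflections in `G`. -/
abbrev Refl (G : Subgroup (V ≃ₗ[ℂ] V)) : Type _ :=
  {r : G // IsReflection (r : V ≃ₗ[ℂ] V)}

instance (G : Subgroup (V ≃ₗ[ℂ] V)) [Finite G] : Fintype (Refl G) := Fintype.ofFinite _

theorem isReflection_conj {G : Subgroup (V ≃ₗ[ℂ] V)} (g r : G)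
    (hr : IsReflection (r : V ≃ₗ[ℂ] V)) :
    IsReflection ((g * r * g⁻¹ : G) : V ≃ₗ[ℂ] V) := by
  have h : (fixedSpace (r : V ≃ₗ[ℂ] V)).map (g : V ≃ₗ[ℂ] V).toLinearMap =
      fixedSpace ((g * r * g⁻¹ : G) : V ≃ₗ[ℂ] V) := by
    ext w
    rw [Submodule.mem_map_equiv]
    have h1 : (g : V ≃ₗ[ℂ] V)⁻¹ w = (g : V ≃ₗ[ℂ] V).symm w := rfl
    simp [fixedSpace, sub_eq_zero, h1, ← LinearEquiv.eq_symm_apply]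
  rw [IsReflection,
    ← (Submodule.Quotient.equiv _ _ (g : V ≃ₗ[ℂ] V) h).finrank_eq]
  exact hr

/-- A parameter `c`: numbers `c_r` for `r ∈ R` with `c_r = c_{g r g⁻¹}` for `g ∈ G`. -/
structure Param (G : Subgroup (V ≃ₗ[ℂ] V)) where
  val : Refl G → ℂ
  conj : ∀ (g : G) (r s : Refl G), s.1 = g * r.1 * g⁻¹ → val s = val r

variable {G : Subgroup (V ≃ₗ[ℂ] V)}

/-- A linear form `α_r` whose kernel is the reflecting hyperplane of `r`. -/
def form (r : Refl G) : Module.Dual ℂ V := Classical.choose (exists_form r.2)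

theorem ker_form (r : Refl G) : LinearMap.ker (form r) = fixedSpace (r.1 : V ≃ₗ[ℂ] V) :=
  Classical.choose_spec (exists_form r.2)

theorem form_ne_zero (r : Refl G) : form r ≠ 0 := by
  intro h
  have h1 := ker_form r
  have h2 := r.2
  rw [h, LinearMap.ker_zero] at h1
  rw [IsReflection, ← h1] at h2
  simp [Module.finrank_zero_of_subsingleton] at h2

theorem coord_form_ne_zero (r : Refl G) : coord (form r) ≠ 0 := by
  intro h
  obtain ⟨y, hy⟩ : ∃ y, form r y ≠ 0 := by
    by_contra! h'
    exact form_ne_zero r (LinearMap.ext h')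
  have h1 := pderiv_coord y (form r)
  rw [h, map_zero] at h1
  exact hy ((map_eq_zero_iff _ (algebraMap ℂ (Poly V)).injective).1 h1.symm)

theorem form_dvd (r : Refl G) (f : Poly V) :
    coord (form r) ∣ f - polyAct (r.1 : V ≃ₗ[ℂ] V) f := by
  induction f using poly_induction with
  | algebraMap z => simp
  | coord x =>
    have hx : ∃ z : ℂ, z • form r = x - LinearMap.dualMap
        ((r.1 : V ≃ₗ[ℂ] V)⁻¹ : V ≃ₗ[ℂ] V).toLinearMap x := by
      rw [← Submodule.mem_span_singleton, ← Set.range_const (ι := Unit)]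
      apply mem_span_of_iInf_ker_le_ker (L := fun _ : Unit => form r)
      intro w hw
      have hw' : (r.1 : V ≃ₗ[ℂ] V) w = w := by
        have : w ∈ fixedSpace (r.1 : V ≃ₗ[ℂ] V) := by
          rw [← ker_form]; simpa using hw
        simpa [fixedSpace, sub_eq_zero] using this
      have hw2 : (r.1 : V ≃ₗ[ℂ] V)⁻¹ w = w := by
        rw [← LinearEquiv.smul_def, inv_smul_eq_iff]; exact hw'.symm
      simp [LinearMap.dualMap_apply, hw2]
    obtain ⟨z, hz⟩ := hx
    refine ⟨algebraMap ℂ _ z, ?_⟩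
    rw [mul_comm, ← Algebra.smul_def, ← map_smul, hz, map_sub]
    simp [polyAct]
  | mul a b ha hb =>
    have : a * b - polyAct (r.1 : V ≃ₗ[ℂ] V) (a * b) =
        (a - polyAct (r.1 : V ≃ₗ[ℂ] V) a) * b +
          polyAct (r.1 : V ≃ₗ[ℂ] V) a * (b - polyAct (r.1 : V ≃ₗ[ℂ] V) b) := by
      rw [map_mul]; ring
    rw [this]
    exact dvd_add (ha.mul_right _) (hb.mul_left _)
  | add a b ha hb =>
    rw [map_add, add_sub_add_comm]
    exact dvd_add ha hb

/-- The operator `f ↦ (f - r(f)) / α_r` on `ℂ[V]`. -/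
def divDiff (r : Refl G) : Module.End ℂ (Poly V) where
  toFun f := Classical.choose (form_dvd r f)
  map_add' f h := by
    apply mul_left_cancel₀ (coord_form_ne_zero r)
    rw [mul_add, ← Classical.choose_spec (form_dvd r f), ← Classical.choose_spec (form_dvd r h),
      ← Classical.choose_spec (form_dvd r (f + h)), map_add, add_sub_add_comm]
  map_smul' z f := by
    apply mul_left_cancel₀ (coord_form_ne_zero r)
    rw [RingHom.id_apply, mul_smul_comm, ← Classical.choose_spec (form_dvd r f),
      ← Classical.choose_spec (form_dvd r (z • f)), map_smul, smul_sub]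

theorem form_mul_divDiff (r : Refl G) (f : Poly V) :
    coord (form r) * divDiff r f = f - polyAct (r.1 : V ≃ₗ[ℂ] V) f :=
  (Classical.choose_spec (form_dvd r f)).symm

variable [Finite G] (c : Param G)

/-- The Dunkl operator `y(f) = ∂_y f - ∑_r c_r ⟨α_r, y⟩ (f - r(f)) / α_r`. -/
def dunkl (y : V) : Module.End ℂ (Poly V) :=
  pderiv y - ∑ r : Refl G, (c.val r * form r y) • divDiff r

/-- The rational Cherednik algebra `H_c(G, V)`: the algebra of operators on `ℂ[V]` generated by
the multiplication operators, the group `G` and the Dunkl operators. -/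
def rca : Subalgebra ℂ (Module.End ℂ (Poly V)) :=
  Algebra.adjoin ℂ
    (Set.range (fun f : Poly V => LinearMap.mulLeft ℂ f) ∪
      Set.range (fun g : G => (polyAct (g : V ≃ₗ[ℂ] V)).toLinearMap) ∪
      Set.range (dunkl c))

/-- `H_c(G, V)` as a type. -/
def RCA : Type _ := rca c

instance : Ring (RCA c) := inferInstanceAs (Ring (rca c))

instance : Algebra ℂ (RCA c) := inferInstanceAs (Algebra ℂ (rca c))

/-- An element of `G`, in `H_c(G, V)`. -/
def groupElt (g : G) : RCA c :=
  ⟨(polyAct (g : V ≃ₗ[ℂ] V)).toLinearMap,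
    Algebra.subset_adjoin (Or.inl (Or.inr ⟨g, rfl⟩))⟩

/-- A Dunkl operator, in `H_c(G, V)`. -/
def dunklElt (y : V) : RCA c :=
  ⟨dunkl c y, Algebra.subset_adjoin (Or.inr ⟨y, rfl⟩)⟩

section Modules

variable {W : Type*} [AddCommGroup W] [Module ℂ W] (ρ : Representation ℂ G W)

/-- The relations of the module induced to `H_c(G, V)` from `W`, where `W` is inflated to the
subalgebra generated by `G` and the Dunkl operators by letting the Dunkl operators act by `0`:
`g ⊗ u = 1 ⊗ g u` for `g ∈ G` and `y ⊗ u = 0` for `y ∈ V`. -/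
def standardRel : Submodule (RCA c) (RCA c ⊗[ℂ] W) :=
  Submodule.span (RCA c)
    ({t | ∃ (g : G) (u : W), t = groupElt c g ⊗ₜ[ℂ] u - (1 : RCA c) ⊗ₜ[ℂ] ρ g u} ∪
      {t | ∃ (y : V) (u : W), t = dunklElt c y ⊗ₜ[ℂ] u})

/-- The standard module `Δ_c(W)`: the module induced from the inflation of `W`. -/
abbrev Standard : Type _ := (RCA c ⊗[ℂ] W) ⧸ standardRel c ρ

/-- `L_c(W) = Δ_c(W) / Rad Δ_c(W)`. -/
abbrev Irred : Type _ := Standard c ρ ⧸ Module.jacobson (RCA c) (Standard c ρ)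

/-- The action of `∑_r c_r (1 - r)` on a representation of `G`. -/
def reflSum : Module.End ℂ W := ∑ r : Refl G, c.val r • (1 - ρ r.1)

theorem reflSum_comm (g : G) : reflSum c ρ * ρ g = ρ g * reflSum c ρ := by
  let e : Refl G ≃ Refl G :=
    { toFun := fun r => ⟨g * r.1 * g⁻¹, isReflection_conj g r.1 r.2⟩
      invFun := fun r => ⟨g⁻¹ * r.1 * g, by simpa using isReflection_conj g⁻¹ r.1 r.2⟩
      left_inv := fun r => Subtype.ext (by simp [mul_assoc])
      right_inv := fun r => Subtype.ext (by simp [mul_assoc]) }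
  rw [reflSum, Finset.sum_mul, Finset.mul_sum, ← e.sum_comp]
  refine Finset.sum_congr rfl fun r _ => ?_
  rw [c.conj g r (e r) rfl, smul_mul_assoc, mul_smul_comm, sub_mul, mul_sub, one_mul, mul_one,
    ← map_mul, ← map_mul]
  simp [e, mul_assoc]

/-- On an irreducible representation, `∑_r c_r (1 - r)` acts by a scalar. -/
theorem exists_cValue [FiniteDimensional ℂ W] (hρ : ρ.IsIrreducible) :
    ∃ z : ℂ, reflSum c ρ = z • 1 := by
  let f : Representation.IntertwiningMap ρ ρ :=
    { reflSum c ρ with isIntertwining' := reflSum_comm c ρ }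
  obtain ⟨z, hz⟩ :=
    (Representation.IsIrreducible.algebraMap_intertwiningMap_bijective_of_isAlgClosed (ρ := ρ)).2 f
  refine ⟨z, LinearMap.ext fun u => ?_⟩
  have := DFunLike.congr_fun hz u
  change f u = _
  simpa [Algebra.algebraMap_eq_smul_one] using this.symm

/-- The scalar by which `∑_r c_r (1 - r)` acts on an irreducible representation. -/
def cValue [FiniteDimensional ℂ W] (hρ : ρ.IsIrreducible) : ℂ :=
  Classical.choose (exists_cValue c ρ hρ)

theorem cValue_spec [FiniteDimensional ℂ W] (hρ : ρ.IsIrreducible) :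
    reflSum c ρ = cValue c ρ hρ • 1 :=
  Classical.choose_spec (exists_cValue c ρ hρ)

end Modules

end Data

/-- The Serre subcategory of an abelian category generated by a class `Q` of objects: the
intersection of all Serre subcategories that contain `Q`. -/
def serreClosure {C : Type*} [Category C] [Abelian C] (Q : ObjectProperty C) :
    ObjectProperty C :=
  fun X => ∀ P : ObjectProperty C, P.IsSerreClass → Q ≤ P → P X

/-- Restriction of a finite dimensional representation to a subgroup. -/
abbrev res {G : Type*} [Group G] (H : Subgroup G) (S : FDRep ℂ G) : FDRep ℂ H :=
  (Action.res (FGModuleCat ℂ) H.subtype).obj S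

end Cherednik

end

/-! Write `Δ` for the standard module, `N` for its radical and `κ` for `c_λ`. As a space `Δ`
consists of sums of elements `f ⊗ u`, graded by the degree of `f`, and evaluation at `v`, `f ⊗ u ↦
f(v) u`, is a `G_S`-equivariant map `Δ → S^λ`. The theorem follows from the values of `N` at `v`.

The Euler element `∑ x_i y_i + ∑ c_r (1 - r)` acts on degree `d` of `Δ` by `κ + d`. Since `Δ/N` is
finite dimensional, some `κ + d` is not an eigenvalue there, so `N` contains all of degree `d`; as
`v ≠ 0`, the values at `v` of the layer `N_d` fill `S^λ` (`exists_map_layer_eq_top`).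

Conversely, `N_0 = 0` because `N` is proper and `S^λ` irreducible. Each `y_i` maps `N_{d+1}` into
`N_d`, so on `N_{d+1} / V* N_d` the Euler element reduces to `∑ c_r (1 - r)`, which therefore acts
by `κ + d + 1`: only `S^μ` with `c_μ - c_λ = d + 1` occur (`reflSum_sub_mem_decomposable`).
Evaluation sends `V* N_d` into the values of `N_d`, so passing from layer `d` to layer `d + 1` adds
to the values at `v` only a quotient of a restriction of such a representation. Induction on `d`
keeps the values inside a subrepresentation in the Serre subcategory (`exists_inClass`).

That evaluation is well defined on the induced module needs the PBW theorem: the `g y^a` form a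
basis of `H_c` over `ℂ[V]`. Spanning comes from the commutation relations (`mem_span_pbw`),
independence from the action on functions near a free orbit, where Dunkl operators are derivatives
up to terms of lower order (`linearIndependent_pbw`). -/

noncomputable section

namespace Cherednik

/-! ### Polynomial functions: evaluation, group action, derivatives, grading. -/

section PolynomialFunctions

variable {V : Type*} [AddCommGroup V] [Module ℂ V]

/-- Evaluation of a polynomial function at a point. -/
def polyEval (b : V) : Poly V →ₐ[ℂ] ℂ := polyLift (Module.Dual.eval ℂ V b)

@[simp]
theorem polyEval_coord (b : V) (x : Module.Dual ℂ V) : polyEval b (coord x) = x b := by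
  simp [polyEval]

theorem eq_zero_of_polyEval [FiniteDimensional ℂ V] {f : Poly V} (h : ∀ b, polyEval b f = 0) :
    f = 0 := by
  let B := Module.finBasis ℂ V
  let e : Poly V ≃ₐ[ℂ] MvPolynomial _ ℂ := SymmetricAlgebra.equivMvPolynomial B.dualBasis
  have key : ∀ (x : Fin (Module.finrank ℂ V) → ℂ) (f : Poly V),
      MvPolynomial.aeval x (e f) = polyEval (B.equivFun.symm x) f := by
    intro x f
    have : ((MvPolynomial.aeval x).comp e.toAlgHom : Poly V →ₐ[ℂ] ℂ) =
        polyEval (B.equivFun.symm x) := by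
      apply poly_hom_ext
      intro y
      have h : ((MvPolynomial.aeval x).comp e.toAlgHom : Poly V →ₐ[ℂ] ℂ).toLinearMap ∘ₗ coord =
          (polyEval (B.equivFun.symm x)).toLinearMap ∘ₗ coord := by
        refine B.dualBasis.ext fun i => ?_
        have : e (coord (B.dualBasis i)) = MvPolynomial.X i :=
          SymmetricAlgebra.equivMvPolynomial_ι_apply _ i
        rw [Module.Basis.coe_dualBasis] at this
        simp [this, Finsupp.single_apply]
      exact LinearMap.congr_fun h y
    exact DFunLike.congr_fun this f
  apply e.injective
  rw [map_zero]
  refine MvPolynomial.funext fun x => ?_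
  rw [map_zero, ← h (B.equivFun.symm x), ← key x f]
  simp

@[simp]
theorem polyAct_coord (g : V ≃ₗ[ℂ] V) (x : Module.Dual ℂ V) :
    polyAct g (coord x) = coord (x ∘ₗ (g⁻¹ : V ≃ₗ[ℂ] V).toLinearMap) := by
  simp [polyAct, LinearMap.dualMap_apply']

theorem polyAct_mul (g h : V ≃ₗ[ℂ] V) (f : Poly V) :
    polyAct (g * h) f = polyAct g (polyAct h f) := by
  have : polyAct (g * h) = (polyAct g).comp (polyAct h) := by
    apply poly_hom_ext
    intro x
    simp [mul_inv_rev]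
    rfl
  exact DFunLike.congr_fun this f

theorem polyAct_one (f : Poly V) : polyAct (1 : V ≃ₗ[ℂ] V) f = f := by
  have : polyAct (1 : V ≃ₗ[ℂ] V) = AlgHom.id ℂ (Poly V) := by
    apply poly_hom_ext
    intro x
    simp
  exact DFunLike.congr_fun this f

theorem polyEval_polyAct (g : V ≃ₗ[ℂ] V) (b : V) (f : Poly V) :
    polyEval b (polyAct g f) = polyEval (g⁻¹ b) f := by
  have : (polyEval b).comp (polyAct g) = polyEval (g⁻¹ b) := by
    apply poly_hom_ext
    intro x
    simp
  exact DFunLike.congr_fun this f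

@[simp]
theorem pderiv_one (y : V) : pderiv y (1 : Poly V) = 0 := by
  simpa using pderiv_mul y 1 1

@[simp]
theorem pderiv_algebraMap (y : V) (z : ℂ) : pderiv y (algebraMap ℂ (Poly V) z) = 0 := by
  simp [Algebra.algebraMap_eq_smul_one]

theorem pderiv_pow_succ (y : V) (f : Poly V) (n : ℕ) :
    pderiv y (f ^ (n + 1)) = (n + 1) * f ^ n * pderiv y f := by
  induction n with
  | zero => simp
  | succ n ih =>
    rw [pow_succ, pderiv_mul, ih]
    push_cast
    ring

theorem pderiv_add (y z : V) (f : Poly V) : pderiv (y + z) f = pderiv y f + pderiv z f := by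
  induction f using poly_induction with
  | algebraMap a => simp
  | coord x => simp [pderiv_coord]
  | mul a b ha hb => simp only [pderiv_mul, ha, hb]; ring
  | add a b ha hb => simp only [map_add, ha, hb]; ring

theorem pderiv_smul (t : ℂ) (y : V) (f : Poly V) : pderiv (t • y) f = t • pderiv y f := by
  induction f using poly_induction with
  | algebraMap a => simp
  | coord x => simp [pderiv_coord, Algebra.smul_def]
  | mul a b ha hb => simp only [pderiv_mul, ha, hb, Algebra.smul_def]; ring
  | add a b ha hb => simp only [map_add, ha, hb, smul_add]

theorem polyAct_pderiv (g : V ≃ₗ[ℂ] V) (y : V) (f : Poly V) :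
    polyAct g (pderiv y f) = pderiv (g y) (polyAct g f) := by
  induction f using poly_induction with
  | algebraMap a => simp
  | coord x =>
    simp [pderiv_coord]
  | mul a b ha hb => simp only [pderiv_mul, map_mul, map_add, ha, hb]
  | add a b ha hb => simp only [map_add, ha, hb]

/-- The polynomial functions that are homogeneous of degree `d`. -/
def homog (V : Type*) [AddCommGroup V] [Module ℂ V] (d : ℕ) : Submodule ℂ (Poly V) :=
  LinearMap.range (coord : Module.Dual ℂ V →ₗ[ℂ] Poly V) ^ d

theorem coord_mul_mem_homog (x : Module.Dual ℂ V) {d : ℕ} {f : Poly V} (hf : f ∈ homog V d) :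
    coord x * f ∈ homog V (d + 1) := by
  rw [homog, pow_succ']
  exact Submodule.mul_mem_mul ⟨x, rfl⟩ hf

theorem coord_pow_mem_homog (x : Module.Dual ℂ V) (d : ℕ) : coord x ^ d ∈ homog V d :=
  Submodule.pow_mem_pow _ (LinearMap.mem_range_self coord x) d

theorem mem_homog_zero {f : Poly V} : f ∈ homog V 0 ↔ ∃ z, algebraMap ℂ (Poly V) z = f := by
  simp [homog, Submodule.mem_one]

theorem homog_induction {motive : (d : ℕ) → Poly V → Prop}
    (algebraMap : ∀ z, motive 0 (algebraMap ℂ (Poly V) z))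
    (coord_mul : ∀ d x f, f ∈ homog V d → motive d f → motive (d + 1) (coord x * f))
    (add : ∀ d f h, motive (d + 1) f → motive (d + 1) h → motive (d + 1) (f + h))
    {d : ℕ} {f : Poly V} (hf : f ∈ homog V d) : motive d f := by
  induction d generalizing f with
  | zero =>
    obtain ⟨z, rfl⟩ := mem_homog_zero.1 hf
    exact algebraMap z
  | succ d ih =>
    rw [homog, pow_succ'] at hf
    induction hf using Submodule.mul_induction_on' with
    | mem_mul_mem x hx f hf =>
      obtain ⟨x, rfl⟩ := hx
      exact coord_mul d x f hf (ih hf)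
    | add f _ h _ hf hh => exact add d f h hf hh

theorem homog_finite [FiniteDimensional ℂ V] (d : ℕ) : (homog V d).FG := by
  refine Submodule.FG.pow ?_ d
  rw [LinearMap.range_eq_map]
  exact Module.Finite.fg_top.map _

theorem polyAct_mem_homog (g : V ≃ₗ[ℂ] V) {d : ℕ} {f : Poly V} (hf : f ∈ homog V d) :
    polyAct g f ∈ homog V d := by
  refine homog_induction (motive := fun d f => polyAct g f ∈ homog V d) ?_ ?_ ?_ hf
  · intro z
    simpa using mem_homog_zero.2 ⟨z, rfl⟩
  · intro d x f _ ih
    rw [map_mul, polyAct_coord]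
    exact coord_mul_mem_homog _ ih
  · intro d f h hf hh
    rw [map_add]
    exact add_mem hf hh

/-- An operator that kills the constants and satisfies a (twisted) Leibniz rule on products with
linear forms lowers the degree by one. -/
theorem lowers_homog (D : Module.End ℂ (Poly V)) (τ : Poly V → Poly V)
    (hτ : ∀ d, ∀ f ∈ homog V d, τ f ∈ homog V d)
    (hD : ∀ z, D (algebraMap ℂ (Poly V) z) = 0)
    (hD' : ∀ x, ∃ z : ℂ, ∀ f, D (coord x * f) = z • τ f + coord x * D f)
    {d : ℕ} {f : Poly V} (hf : f ∈ homog V (d + 1)) : D f ∈ homog V d := by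
  refine homog_induction (motive := fun e f => ∀ d, e = d + 1 → D f ∈ homog V d)
    ?_ ?_ ?_ hf d rfl
  · simp
  · rintro d x f hf ih _ ⟨⟩
    obtain ⟨z, hz⟩ := hD' x
    rw [hz]
    refine add_mem (Submodule.smul_mem _ _ (hτ d f hf)) ?_
    cases d with
    | zero =>
      obtain ⟨z, rfl⟩ := mem_homog_zero.1 hf
      simp [hD]
    | succ d => exact coord_mul_mem_homog x (ih d rfl)
  · intro d f h hf hh e he
    rw [map_add]
    exact add_mem (hf e he) (hh e he)

theorem pderiv_mem_homog (y : V) {d : ℕ} {f : Poly V} (hf : f ∈ homog V (d + 1)) :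
    pderiv y f ∈ homog V d :=
  lowers_homog (pderiv y) id (fun _ _ h => h) (pderiv_algebraMap y)
    (fun x => ⟨x y, fun f => by
      rw [pderiv_mul, pderiv_coord, ← Algebra.smul_def, add_comm, id]⟩) hf

end PolynomialFunctions

/-! ### Dunkl operators: equivariance, commutativity and the Euler field. -/

section DunklOperators

variable {V : Type*} [AddCommGroup V] [Module ℂ V] {G : Subgroup (V ≃ₗ[ℂ] V)}

theorem form_eq_zero_iff (r : Refl G) (w : V) : form r w = 0 ↔ (r.1 : V ≃ₗ[ℂ] V) w = w := by
  rw [← LinearMap.mem_ker, ker_form, fixedSpace, LinearMap.mem_ker]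
  simp [sub_eq_zero]

theorem exists_form_eq_one (r : Refl G) : ∃ y, form r y = 1 := by
  obtain ⟨y, hy⟩ : ∃ y, form r y ≠ 0 := by
    by_contra! h
    exact form_ne_zero r (LinearMap.ext h)
  exact ⟨(form r y)⁻¹ • y, by simp [hy]⟩

/-- A linear map that vanishes on the hyperplane of `r` factors through `α_r`. -/
theorem exists_eq_form_smul {E : Type*} [AddCommGroup E] [Module ℂ E] (r : Refl G)
    (T : V →ₗ[ℂ] E) (hT : ∀ w, (r.1 : V ≃ₗ[ℂ] V) w = w → T w = 0) :
    ∃ γ, ∀ y, T y = form r y • γ := by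
  obtain ⟨y₀, h₀⟩ := exists_form_eq_one r
  refine ⟨T y₀, fun y => ?_⟩
  have h := hT (y - form r y • y₀) ((form_eq_zero_iff r _).1 (by simp [h₀]))
  rwa [map_sub, map_smul, sub_eq_zero] at h

theorem exists_coroot (r : Refl G) :
    ∃ γ : V, ∀ y, (r.1 : V ≃ₗ[ℂ] V) y = y + form r y • γ := by
  obtain ⟨γ, hγ⟩ := exists_eq_form_smul r
    ((r.1 : V ≃ₗ[ℂ] V).toLinearMap - LinearMap.id) (fun w hw => by simp [hw])
  exact ⟨γ, fun y => by rw [← hγ y]; simp⟩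

theorem divDiff_mul (r : Refl G) (f h : Poly V) :
    divDiff r (f * h) = divDiff r f * polyAct (r.1 : V ≃ₗ[ℂ] V) h + f * divDiff r h := by
  apply mul_left_cancel₀ (coord_form_ne_zero r)
  have h1 := form_mul_divDiff r f
  have h2 := form_mul_divDiff r h
  rw [form_mul_divDiff, map_mul]
  linear_combination (-polyAct (r.1 : V ≃ₗ[ℂ] V) h) * h1 - f * h2

theorem divDiff_algebraMap (r : Refl G) (z : ℂ) : divDiff r (algebraMap ℂ (Poly V) z) = 0 := by
  apply mul_left_cancel₀ (coord_form_ne_zero r)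
  rw [form_mul_divDiff]
  simp

theorem exists_divDiff_coord (r : Refl G) (x : Module.Dual ℂ V) :
    ∃ z : ℂ, divDiff r (coord x) = algebraMap ℂ (Poly V) z := by
  obtain ⟨z, hz⟩ := exists_eq_form_smul r
    (x - x ∘ₗ ((r.1 : V ≃ₗ[ℂ] V)⁻¹ : V ≃ₗ[ℂ] V).toLinearMap) (fun w hw => by
      have hw2 : (r.1 : V ≃ₗ[ℂ] V).symm w = w := by
        rw [LinearEquiv.symm_apply_eq]; exact hw.symm
      simp [hw2])
  refine ⟨z, mul_left_cancel₀ (coord_form_ne_zero r) ?_⟩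
  rw [form_mul_divDiff, polyAct_coord, mul_comm, ← Algebra.smul_def, ← map_smul, ← map_sub]
  congr 1
  ext y
  rw [hz y]
  simp [mul_comm]

theorem divDiff_mem_homog (r : Refl G) {d : ℕ} {f : Poly V} (hf : f ∈ homog V (d + 1)) :
    divDiff r f ∈ homog V d :=
  lowers_homog (divDiff r) (polyAct (r.1 : V ≃ₗ[ℂ] V)) (fun _ _ h => polyAct_mem_homog _ h)
    (divDiff_algebraMap r)
    (fun x => by
      obtain ⟨z, hz⟩ := exists_divDiff_coord r x
      exact ⟨z, fun f => by rw [divDiff_mul, hz, ← Algebra.smul_def]⟩) hf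

/-- Conjugation by `g` as a permutation of the reflections. -/
def reflConj (g : G) : Refl G ≃ Refl G where
  toFun r := ⟨g * r.1 * g⁻¹, isReflection_conj g r.1 r.2⟩
  invFun r := ⟨g⁻¹ * r.1 * g, by simpa using isReflection_conj g⁻¹ r.1 r.2⟩
  left_inv r := Subtype.ext (by simp [mul_assoc])
  right_inv r := Subtype.ext (by simp [mul_assoc])

/-- The forms are chosen independently for each reflection, so the form of `g r g⁻¹` is only
proportional to the translate of `α_r`. The factors `form _ _` on both sides absorb the unknown
constant. -/
theorem polyAct_divDiff (g : G) (r : Refl G) (y : V) (f : Poly V) :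
    form r y • polyAct (g : V ≃ₗ[ℂ] V) (divDiff r f) =
      form (reflConj g r) ((g : V ≃ₗ[ℂ] V) y) •
        divDiff (reflConj g r) (polyAct (g : V ≃ₗ[ℂ] V) f) := by
  obtain ⟨t, ht⟩ := exists_eq_form_smul r
    (form (reflConj g r) ∘ₗ (g : V ≃ₗ[ℂ] V).toLinearMap) (fun w hw => by
      rw [LinearMap.comp_apply, form_eq_zero_iff]
      simp [reflConj, hw])
  have h1 : coord (form (reflConj g r)) = t • polyAct (g : V ≃ₗ[ℂ] V) (coord (form r)) := by
    rw [polyAct_coord, ← map_smul]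
    congr 1
    ext w
    have := ht ((g : V ≃ₗ[ℂ] V)⁻¹ w)
    have h2 : (g : V ≃ₗ[ℂ] V) ((g : V ≃ₗ[ℂ] V)⁻¹ w) = w :=
      (g : V ≃ₗ[ℂ] V).apply_symm_apply w
    simpa [h2, mul_comm] using this
  apply mul_left_cancel₀ (coord_form_ne_zero (reflConj g r))
  rw [mul_smul_comm, mul_smul_comm, form_mul_divDiff, h1, smul_mul_assoc, ← map_mul,
    form_mul_divDiff, ← polyAct_mul]
  have h3 : (((reflConj g r).1 : G) : V ≃ₗ[ℂ] V) * (g : V ≃ₗ[ℂ] V) =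
      (g : V ≃ₗ[ℂ] V) * (r.1 : V ≃ₗ[ℂ] V) := by
    simp [reflConj]
  have h4 : form (reflConj g r) ((g : V ≃ₗ[ℂ] V) y) = form r y * t := ht y
  rw [h3, h4, polyAct_mul, map_sub, smul_smul]

variable [Finite G] (c : Param G)

theorem dunkl_apply (y : V) (f : Poly V) :
    dunkl c y f = pderiv y f - ∑ r : Refl G, (c.val r * form r y) • divDiff r f := by
  simp [dunkl]

theorem dunkl_add (y z : V) : dunkl c (y + z) = dunkl c y + dunkl c z := by
  ext f
  simp only [dunkl_apply, pderiv_add, map_add, mul_add, add_smul, Finset.sum_add_distrib,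
    LinearMap.add_apply]
  abel

theorem dunkl_smul (t : ℂ) (y : V) : dunkl c (t • y) = t • dunkl c y := by
  ext f
  simp only [dunkl_apply, pderiv_smul, map_smul, LinearMap.smul_apply, smul_sub, Finset.smul_sum,
    smul_smul, smul_eq_mul]
  simp only [mul_left_comm]

/-- The Dunkl operators, as a linear map on `V`. -/
def dunklMap : V →ₗ[ℂ] Module.End ℂ (Poly V) where
  toFun := dunkl c
  map_add' := dunkl_add c
  map_smul' := dunkl_smul c

@[simp]
theorem dunklMap_apply (y : V) : dunklMap c y = dunkl c y := rfl

@[simp]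
theorem dunkl_one (y : V) : dunkl c y 1 = 0 := by
  have h (r : Refl G) : divDiff r (1 : Poly V) = 0 := by simpa using divDiff_algebraMap r 1
  simp [dunkl_apply, h]

/-- The commutation relation between Dunkl operators and multiplication operators. -/
theorem dunkl_mul (y : V) (f h : Poly V) :
    dunkl c y (f * h) = f * dunkl c y h + (pderiv y f * h -
      ∑ r : Refl G, (c.val r * form r y) • (divDiff r f * polyAct (r.1 : V ≃ₗ[ℂ] V) h)) := by
  simp only [dunkl_apply, pderiv_mul, divDiff_mul, smul_add, Finset.sum_add_distrib, mul_sub,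
    Finset.mul_sum, mul_smul_comm]
  ring

theorem polyAct_dunkl (g : G) (y : V) (f : Poly V) :
    polyAct (g : V ≃ₗ[ℂ] V) (dunkl c y f) =
      dunkl c ((g : V ≃ₗ[ℂ] V) y) (polyAct (g : V ≃ₗ[ℂ] V) f) := by
  rw [dunkl_apply, dunkl_apply, map_sub, polyAct_pderiv, map_sum]
  congr 1
  refine (Finset.sum_congr rfl fun r _ => ?_).trans ((reflConj g).sum_comp fun r =>
    (c.val r * form r ((g : V ≃ₗ[ℂ] V) y)) • divDiff r (polyAct (g : V ≃ₗ[ℂ] V) f))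
  rw [c.conj g r (reflConj g r) rfl, map_smul, mul_smul, mul_smul, polyAct_divDiff]

/-- The commutator of two Dunkl operators is `ℂ[V]`-linear and kills `1`, hence is zero. Linearity
need only be tested on linear forms. -/
theorem dunkl_comm (y z : V) (f : Poly V) :
    dunkl c y (dunkl c z f) = dunkl c z (dunkl c y f) := by
  set D : Module.End ℂ (Poly V) := dunkl c y * dunkl c z - dunkl c z * dunkl c y with hD
  have key : ∀ f h, D (f * h) = f * D h := by
    intro f
    induction f using poly_induction with
    | algebraMap a => intro h; simp [← Algebra.smul_def]
    | mul a b ha hb => intro h; rw [mul_assoc, ha, hb, mul_assoc]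
    | add a b ha hb => intro h; rw [add_mul, map_add, ha, hb, add_mul]
    | coord x =>
      intro h
      choose β hβ using fun r : Refl G => exists_divDiff_coord r x
      choose γ hγ using fun r : Refl G => exists_coroot r
      have h1 (y : V) (h : Poly V) : dunkl c y (coord x * h) = coord x * dunkl c y h +
          (x y • h - ∑ r : Refl G, (c.val r * form r y) •
            (β r • polyAct (r.1 : V ≃ₗ[ℂ] V) h)) := by
        simp only [dunkl_mul, pderiv_coord, hβ, ← Algebra.smul_def]
      have h2 (r : Refl G) (y : V) (h : Poly V) :
          polyAct (r.1 : V ≃ₗ[ℂ] V) (dunkl c y h) =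
            dunkl c y (polyAct (r.1 : V ≃ₗ[ℂ] V) h) +
              form r y • dunkl c (γ r) (polyAct (r.1 : V ≃ₗ[ℂ] V) h) := by
        rw [polyAct_dunkl, hγ r y, dunkl_add, dunkl_smul]
        rfl
      simp only [hD, LinearMap.sub_apply, Module.End.mul_apply, h1, map_add, map_sub, map_smul,
        map_sum, h2, smul_add, Finset.sum_add_distrib, mul_sub]
      -- Moving `r` past a Dunkl operator leaves an error along the coroot `γ r`; its coefficient is
      -- symmetric in `y` and `z`, so it cancels in the commutator.
      have h3 : ∑ r : Refl G, (c.val r * form r y) • β r • form r z •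
            dunkl c (γ r) (polyAct (r.1 : V ≃ₗ[ℂ] V) h) =
          ∑ r : Refl G, (c.val r * form r z) • β r • form r y •
            dunkl c (γ r) (polyAct (r.1 : V ≃ₗ[ℂ] V) h) := by
        refine Finset.sum_congr rfl fun r _ => ?_
        simp only [smul_smul]
        congr 1
        ring
      rw [h3]
      abel
  have h := key f 1
  rw [mul_one] at h
  have h' : D 1 = 0 := by simp [hD]
  rw [h', mul_zero] at h
  exact sub_eq_zero.1 h

/-- The Euler vector field on `ℂ[V]`. -/
def euler (V : Type*) [AddCommGroup V] [Module ℂ V] [FiniteDimensional ℂ V] :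
    Module.End ℂ (Poly V) :=
  ∑ i, LinearMap.mulLeft ℂ (coord ((Module.finBasis ℂ V).coord i)) *
    pderiv (Module.finBasis ℂ V i)

variable [FiniteDimensional ℂ V]

theorem euler_apply (f : Poly V) : euler V f =
    ∑ i, coord ((Module.finBasis ℂ V).coord i) * pderiv (Module.finBasis ℂ V i) f := by
  simp [euler]

theorem sum_smul_coord (x : Module.Dual ℂ V) :
    ∑ i, x (Module.finBasis ℂ V i) • coord ((Module.finBasis ℂ V).coord i) = coord x := by
  simp only [← map_smul, ← map_sum]
  congr 1
  exact (Module.finBasis ℂ V).sum_dual_apply_smul_coord x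

theorem euler_mul (f h : Poly V) : euler V (f * h) = f * euler V h + euler V f * h := by
  simp only [euler_apply, pderiv_mul, Finset.mul_sum, Finset.sum_mul, ← Finset.sum_add_distrib]
  refine Finset.sum_congr rfl fun i _ => ?_
  ring

theorem euler_eq {d : ℕ} {f : Poly V} (hf : f ∈ homog V d) : euler V f = (d : ℂ) • f := by
  refine homog_induction (motive := fun d f => euler V f = (d : ℂ) • f) ?_ ?_ ?_ hf
  · intro z
    simp [euler_apply]
  · intro d x f _ ih
    have : euler V (coord x) = coord x := by
      rw [euler_apply, ← sum_smul_coord x]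
      simp only [pderiv_coord, mul_comm, ← Algebra.smul_def, sum_smul_coord]
    rw [euler_mul, ih, this, mul_smul_comm]
    push_cast
    module
  · intro d f h hf hh
    rw [map_add, hf, hh, smul_add]

/-- The Euler field, in terms of Dunkl operators. -/
theorem sum_coord_mul_dunkl (f : Poly V) :
    ∑ i, coord ((Module.finBasis ℂ V).coord i) * dunkl c (Module.finBasis ℂ V i) f +
      ∑ r : Refl G, c.val r • (f - polyAct (r.1 : V ≃ₗ[ℂ] V) f) = euler V f := by
  simp only [dunkl_apply, mul_sub, Finset.sum_sub_distrib, ← euler_apply]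
  have : ∑ i, coord ((Module.finBasis ℂ V).coord i) *
      ∑ r : Refl G, (c.val r * form r (Module.finBasis ℂ V i)) • divDiff r f =
      ∑ r : Refl G, c.val r • (f - polyAct (r.1 : V ≃ₗ[ℂ] V) f) := by
    simp only [Finset.mul_sum]
    rw [Finset.sum_comm]
    refine Finset.sum_congr rfl fun r _ => ?_
    rw [← form_mul_divDiff, ← sum_smul_coord (form r), Finset.sum_mul, Finset.smul_sum]
    refine Finset.sum_congr rfl fun i _ => ?_
    rw [smul_mul_assoc, mul_smul_comm, mul_smul]
  rw [this]
  abel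

end DunklOperators

/-! ### The ideal of a free orbit and the local behaviour of Dunkl operators. -/

section OrbitIdeal

variable {V : Type*} [AddCommGroup V] [Module ℂ V] (G : Subgroup (V ≃ₗ[ℂ] V))

/-- The ideal of polynomial functions that vanish on the orbit of `b`. -/
def orbitIdeal (b : V) : Ideal (Poly V) :=
  ⨅ g : G, RingHom.ker (polyEval ((g : V ≃ₗ[ℂ] V) b))

variable {G} {b : V}

theorem mem_orbitIdeal {f : Poly V} :
    f ∈ orbitIdeal G b ↔ ∀ g : G, polyEval ((g : V ≃ₗ[ℂ] V) b) f = 0 := by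
  simp [orbitIdeal, Submodule.mem_iInf]

theorem polyAct_mem_orbitIdeal_pow (g : G) {m : ℕ} {f : Poly V}
    (hf : f ∈ orbitIdeal G b ^ m) :
    polyAct (g : V ≃ₗ[ℂ] V) f ∈ orbitIdeal G b ^ m := by
  have h : (orbitIdeal G b).map (polyAct (g : V ≃ₗ[ℂ] V)) ≤ orbitIdeal G b := by
    rw [Ideal.map_le_iff_le_comap]
    intro f hf
    rw [Ideal.mem_comap, mem_orbitIdeal]
    intro k
    rw [polyEval_polyAct]
    exact mem_orbitIdeal.1 hf (g⁻¹ * k)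
  have h2 := Ideal.mem_map_of_mem (polyAct (g : V ≃ₗ[ℂ] V)) hf
  rw [Ideal.map_pow] at h2
  exact Ideal.pow_right_mono h m h2

theorem pderiv_mem_orbitIdeal_pow (y : V) {m : ℕ} {f : Poly V}
    (hf : f ∈ orbitIdeal G b ^ (m + 1)) : pderiv y f ∈ orbitIdeal G b ^ m := by
  induction m generalizing f with
  | zero => simp
  | succ m ih =>
    rw [pow_succ'] at hf
    induction hf using Submodule.mul_induction_on' with
    | mem_mul_mem f hf h hh =>
      rw [pderiv_mul]
      refine add_mem ?_ (Ideal.mul_mem_left _ _ hh)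
      rw [pow_succ']
      exact Ideal.mul_mem_mul hf (ih hh)
    | add f _ h _ hf hh =>
      rw [map_add]
      exact add_mem hf hh

theorem form_ne_zero_of_regular (hb : ∀ g : G, (g : V ≃ₗ[ℂ] V) b = b → g = 1) (r : Refl G)
    (g : G) : form r ((g : V ≃ₗ[ℂ] V) b) ≠ 0 := by
  intro h
  rw [form_eq_zero_iff] at h
  have h1 : r.1 = 1 := by
    have h2 : g⁻¹ * r.1 * g = 1 := hb _ (by
      change (g : V ≃ₗ[ℂ] V).symm ((r.1 : V ≃ₗ[ℂ] V) ((g : V ≃ₗ[ℂ] V) b)) = b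
      rw [h, LinearEquiv.symm_apply_apply])
    have h3 : r.1 = g * (g⁻¹ * r.1 * g) * g⁻¹ := by group
    rw [h3, h2]
    group
  refine form_ne_zero r (LinearMap.ext fun w => (form_eq_zero_iff r w).2 ?_)
  rw [h1]
  rfl

variable [Finite G]

theorem exists_form_dvd_one_sub (hb : ∀ g : G, (g : V ≃ₗ[ℂ] V) b = b → g = 1) (r : Refl G) :
    ∃ t ∈ orbitIdeal G b, coord (form r) ∣ 1 - t := by
  have := Fintype.ofFinite G
  -- The factor of index `g` vanishes at `g b`, and every factor is `1` modulo `α_r`.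
  refine ⟨∏ g : G, (1 - algebraMap ℂ (Poly V) (form r ((g : V ≃ₗ[ℂ] V) b))⁻¹ * coord (form r)),
    ?_, ?_⟩
  · rw [mem_orbitIdeal]
    intro g
    rw [map_prod]
    refine Finset.prod_eq_zero (Finset.mem_univ g) ?_
    simp [form_ne_zero_of_regular hb r g]
  · refine Finset.prod_induction _ (fun p => coord (form r) ∣ 1 - p) ?_ (by simp) ?_
    · intro p q hp hq
      have : 1 - p * q = (1 - p) + p * (1 - q) := by ring
      rw [this]
      exact dvd_add hp (hq.mul_left p)
    · intro g _
      rw [sub_sub_cancel]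
      exact dvd_mul_left _ _

/-- `α_r` has no zero on the free orbit, so it is invertible modulo every power of the orbit ideal.
With `1 = t + α_r s` and `t` in the ideal, each use of `f = s α_r f + t f` gains one power. -/
theorem mem_orbitIdeal_pow_of_form_mul (hb : ∀ g : G, (g : V ≃ₗ[ℂ] V) b = b → g = 1)
    (r : Refl G) {m : ℕ} {f : Poly V} (hf : coord (form r) * f ∈ orbitIdeal G b ^ m) :
    f ∈ orbitIdeal G b ^ m := by
  obtain ⟨t, ht, s, hs⟩ := exists_form_dvd_one_sub hb r
  have : ∀ j ≤ m, f ∈ orbitIdeal G b ^ j := by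
    intro j
    induction j with
    | zero => simp
    | succ j ih =>
      intro hj
      have h1 : f = s * (coord (form r) * f) + t * f := by linear_combination f * hs
      rw [h1]
      refine add_mem (Ideal.mul_mem_left _ _ (Ideal.pow_le_pow_right hj hf)) ?_
      rw [pow_succ']
      exact Ideal.mul_mem_mul ht (ih (by omega))
  exact this m le_rfl

theorem divDiff_mem_orbitIdeal_pow (hb : ∀ g : G, (g : V ≃ₗ[ℂ] V) b = b → g = 1)
    (r : Refl G) {m : ℕ} {f : Poly V} (hf : f ∈ orbitIdeal G b ^ m) :
    divDiff r f ∈ orbitIdeal G b ^ m := by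
  apply mem_orbitIdeal_pow_of_form_mul hb r
  rw [form_mul_divDiff]
  exact sub_mem hf (polyAct_mem_orbitIdeal_pow r.1 hf)

theorem smul_mem_ideal {I : Ideal (Poly V)} (z : ℂ) {f : Poly V} (hf : f ∈ I) : z • f ∈ I := by
  rw [Algebra.smul_def]
  exact I.mul_mem_left _ hf

variable (c : Param G)

/-- The reflection terms preserve the order of vanishing along a free orbit, while a derivative may
lower it by one; so the derivative is the leading part of a Dunkl operator. -/
theorem dunkl_sub_pderiv_mem (hb : ∀ g : G, (g : V ≃ₗ[ℂ] V) b = b → g = 1)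
    (y : V) {m : ℕ} {f : Poly V} (hf : f ∈ orbitIdeal G b ^ m) :
    dunkl c y f - pderiv y f ∈ orbitIdeal G b ^ m := by
  rw [dunkl_apply, sub_sub_cancel_left]
  exact neg_mem (sum_mem fun r _ => smul_mem_ideal _ (divDiff_mem_orbitIdeal_pow hb r hf))

theorem dunkl_mem_orbitIdeal_pow (hb : ∀ g : G, (g : V ≃ₗ[ℂ] V) b = b → g = 1)
    (y : V) {m : ℕ} {f : Poly V} (hf : f ∈ orbitIdeal G b ^ (m + 1)) :
    dunkl c y f ∈ orbitIdeal G b ^ m := by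
  have h := Ideal.pow_le_pow_right (Nat.le_succ m) (dunkl_sub_pderiv_mem c hb y hf)
  simpa using add_mem h (pderiv_mem_orbitIdeal_pow y hf)

open Classical in
-- Lagrange interpolation: the orbit points are distinct, so linear forms separate them.
theorem exists_indicator (hb : ∀ g : G, (g : V ≃ₗ[ℂ] V) b = b → g = 1) (h : G) :
    ∃ q : Poly V, ∀ g : G, polyEval ((g : V ≃ₗ[ℂ] V) b) q = if g = h then 1 else 0 := by
  have := Fintype.ofFinite G
  have sep : ∀ g : G, g ≠ h → ∃ x : Module.Dual ℂ V,
      x ((h : V ≃ₗ[ℂ] V) b) - x ((g : V ≃ₗ[ℂ] V) b) ≠ 0 := by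
    intro g hg
    by_contra! hx
    have h1 : (h : V ≃ₗ[ℂ] V) b - (g : V ≃ₗ[ℂ] V) b = 0 := by
      rw [← Module.forall_dual_apply_eq_zero_iff ℂ]
      intro x
      rw [map_sub, hx]
    have h2 : h⁻¹ * g = 1 := hb _ (by
      change (h : V ≃ₗ[ℂ] V).symm ((g : V ≃ₗ[ℂ] V) b) = b
      rw [LinearEquiv.symm_apply_eq, sub_eq_zero.1 h1])
    exact hg (inv_mul_eq_one.1 h2).symm
  choose x hx using sep
  refine ⟨∏ g : G, if hg : g = h then 1 else
    algebraMap ℂ (Poly V) (x g hg ((h : V ≃ₗ[ℂ] V) b) - x g hg ((g : V ≃ₗ[ℂ] V) b))⁻¹ *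
      (coord (x g hg) - algebraMap ℂ (Poly V) (x g hg ((g : V ≃ₗ[ℂ] V) b))), fun g => ?_⟩
  rw [map_prod]
  split_ifs with hg
  · subst hg
    refine Finset.prod_eq_one fun k _ => ?_
    split_ifs with hk
    · simp
    · simp [hx k hk]
  · refine Finset.prod_eq_zero (Finset.mem_univ g) ?_
    simp [hg]

open Classical in
/-- A function supported at one point of the orbit, and a function that vanishes on the orbit and
whose derivative there is a given covector at that point and zero elsewhere. -/
theorem exists_test (hb : ∀ g : G, (g : V ≃ₗ[ℂ] V) b = b → g = 1) (h : G)
    (x : Module.Dual ℂ V) :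
    ∃ q u : Poly V, (∀ g : G, polyEval ((g : V ≃ₗ[ℂ] V) b) q = if g = h then 1 else 0) ∧
      u ∈ orbitIdeal G b ∧ ∀ y, pderiv y u - x y • q ∈ orbitIdeal G b := by
  obtain ⟨q, hq⟩ := exists_indicator hb h
  -- The factor `q` is squared so that the derivative also vanishes at the other orbit points.
  refine ⟨q, q * q * (coord x - algebraMap ℂ _ (x ((h : V ≃ₗ[ℂ] V) b))), hq, ?_, fun y => ?_⟩
  · rw [mem_orbitIdeal]
    intro g
    by_cases hg : g = h
    · simp [hg]
    · simp [hq, hg]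
  · rw [mem_orbitIdeal]
    intro g
    by_cases hg : g = h
    · simp [pderiv_mul, pderiv_coord, hq, hg]
    · simp [pderiv_mul, pderiv_coord, hq, hg]

theorem dunkl_test (hb : ∀ g : G, (g : V ≃ₗ[ℂ] V) b = b → g = 1) {q u : Poly V} {y : V} {t : ℂ}
    (hq : q * q - q ∈ orbitIdeal G b) (hu : u ∈ orbitIdeal G b)
    (hy : pderiv y u - t • q ∈ orbitIdeal G b) (m : ℕ) :
    dunkl c y (q * u ^ (m + 1)) - ((m + 1 : ℂ) * t) • (q * u ^ m) ∈
      orbitIdeal G b ^ (m + 1) := by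
  have hm := Ideal.pow_mem_pow hu (m + 1)
  have hm' := Ideal.pow_mem_pow hu m
  have h1 := dunkl_sub_pderiv_mem c hb y (Ideal.mul_mem_left _ q hm)
  have h2 : pderiv y (q * u ^ (m + 1)) - ((m + 1 : ℂ) * t) • (q * u ^ m) =
      pderiv y q * u ^ (m + 1) +
        ((m + 1 : Poly V) * q * ((pderiv y u - t • q) * u ^ m) +
          (m + 1 : Poly V) * algebraMap ℂ (Poly V) t * ((q * q - q) * u ^ m)) := by
    rw [pderiv_mul, pderiv_pow_succ]
    simp only [Algebra.smul_def, map_mul, map_add, map_natCast, map_one]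
    ring
  have h3 : pderiv y (q * u ^ (m + 1)) - ((m + 1 : ℂ) * t) • (q * u ^ m) ∈
      orbitIdeal G b ^ (m + 1) := by
    rw [h2]
    refine add_mem (Ideal.mul_mem_left _ _ hm) (add_mem ?_ ?_)
    · refine Ideal.mul_mem_left _ _ ?_
      rw [pow_succ']
      exact Ideal.mul_mem_mul hy hm'
    · refine Ideal.mul_mem_left _ _ ?_
      rw [pow_succ']
      exact Ideal.mul_mem_mul hq hm'
  simpa using add_mem h1 h3

end OrbitIdeal

/-! ### The PBW theorem for operators on `ℂ[V]`. -/

section PBW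

variable {V : Type*} [AddCommGroup V] [Module ℂ V] [FiniteDimensional ℂ V]
  {G : Subgroup (V ≃ₗ[ℂ] V)} [Finite G] (c : Param G)

/-- The monomials in the Dunkl operators of a basis of `V`. -/
def dunklMon (s : Multiset (Fin (Module.finrank ℂ V))) : Module.End ℂ (Poly V) :=
  (s.map fun i => dunkl c (Module.finBasis ℂ V i)).noncommProd (by
    intro S hS T hT _
    obtain ⟨i, _, rfl⟩ := Multiset.mem_map.1 hS
    obtain ⟨j, _, rfl⟩ := Multiset.mem_map.1 hT
    exact LinearMap.ext fun f => dunkl_comm c _ _ f)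

@[simp]
theorem dunklMon_zero : dunklMon c 0 = 1 := by
  simp [dunklMon]

theorem dunklMon_cons (i : Fin (Module.finrank ℂ V)) (s : Multiset (Fin (Module.finrank ℂ V))) :
    dunklMon c (i ::ₘ s) = dunkl c (Module.finBasis ℂ V i) * dunklMon c s := by
  simp [dunklMon]

theorem dunklMon_cons' (i : Fin (Module.finrank ℂ V)) (s : Multiset (Fin (Module.finrank ℂ V))) :
    dunklMon c (i ::ₘ s) = dunklMon c s * dunkl c (Module.finBasis ℂ V i) := by
  simp only [dunklMon, Multiset.map_cons, Multiset.noncommProd_cons']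

/-- A monomial of degree `k` lowers `u ^ (m + k)` to `u ^ m` with leading coefficient its value at
`x`, times a constant that depends only on `k` and `m`, namely `N = (m + 1) ⋯ (m + k)`. -/
theorem dunklMon_test {b : V} (hb : ∀ g : G, (g : V ≃ₗ[ℂ] V) b = b → g = 1) {q u : Poly V}
    {x : Module.Dual ℂ V} (hq : q * q - q ∈ orbitIdeal G b) (hu : u ∈ orbitIdeal G b)
    (hy : ∀ y, pderiv y u - x y • q ∈ orbitIdeal G b) (k m : ℕ) :
    ∃ N : ℂ, N ≠ 0 ∧ ∀ s : Multiset (Fin (Module.finrank ℂ V)), s.card = k →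
      dunklMon c s (q * u ^ (m + k)) -
        (N * (s.map fun i => x (Module.finBasis ℂ V i)).prod) • (q * u ^ m) ∈
          orbitIdeal G b ^ (m + 1) := by
  induction k generalizing m with
  | zero =>
    refine ⟨1, one_ne_zero, fun s hs => ?_⟩
    obtain rfl := Multiset.card_eq_zero.1 hs
    simp
  | succ k ih =>
    obtain ⟨N, hN, h⟩ := ih (m + 1)
    refine ⟨N * (m + 1), mul_ne_zero hN (Nat.cast_add_one_ne_zero m), fun s hs => ?_⟩
    obtain ⟨i, t, rfl⟩ : ∃ i t, s = i ::ₘ t := by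
      obtain ⟨i, hi⟩ := Multiset.card_pos_iff_exists_mem.1 (by omega : 0 < s.card)
      exact ⟨i, _, (Multiset.cons_erase hi).symm⟩
    rw [Multiset.card_cons, add_left_inj] at hs
    have h1 := dunkl_mem_orbitIdeal_pow c hb (Module.finBasis ℂ V i) (h t hs)
    have h2 := smul_mem_ideal (N * (t.map fun i => x (Module.finBasis ℂ V i)).prod)
      (dunkl_test c hb hq hu (hy (Module.finBasis ℂ V i)) m)
    have h3 := add_mem h1 h2
    rw [map_sub, map_smul, smul_sub, sub_add_sub_cancel, smul_smul] at h3
    rw [dunklMon_cons, Multiset.map_cons, Multiset.prod_cons, Module.End.mul_apply,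
      show m + (k + 1) = m + 1 + k by ring]
    convert h3 using 3
    ring

/-- A nonzero polynomial function such that the points where it does not vanish have trivial
stabilizer. -/
theorem exists_regular (G : Subgroup (V ≃ₗ[ℂ] V)) [Finite G] :
    ∃ δ : Poly V, δ ≠ 0 ∧ ∀ b, polyEval b δ ≠ 0 →
      ∀ g : G, (g : V ≃ₗ[ℂ] V) b = b → g = 1 := by
  classical
  have := Fintype.ofFinite G
  have h : ∀ g : G, g ≠ 1 → ∃ x : Module.Dual ℂ V, x ≠ 0 ∧
      ∀ b, (g : V ≃ₗ[ℂ] V) b = b → x b = 0 := by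
    intro g hg
    obtain ⟨w, hw⟩ : ∃ w, (g : V ≃ₗ[ℂ] V) w - w ≠ 0 := by
      by_contra! hw
      exact hg (Subtype.ext (LinearEquiv.ext fun w => sub_eq_zero.1 (hw w)))
    obtain ⟨x, hx⟩ : ∃ x : Module.Dual ℂ V, x ((g : V ≃ₗ[ℂ] V) w - w) ≠ 0 := by
      by_contra! hx
      exact hw ((Module.forall_dual_apply_eq_zero_iff ℂ _).1 hx)
    -- The form `x ∘ g - x` vanishes on the fixed vectors of `g`; the product of such forms will be
    -- `δ`.
    refine ⟨x ∘ₗ (g : V ≃ₗ[ℂ] V).toLinearMap - x, fun h0 => hx ?_, fun b hb => by simp [hb]⟩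
    simpa using LinearMap.congr_fun h0 w
  choose x hx hx' using h
  refine ⟨∏ g : G, if hg : g = 1 then 1 else coord (x g hg), ?_, fun b hb g hg => ?_⟩
  · rw [Finset.prod_ne_zero_iff]
    intro g _
    split_ifs with hg
    · exact one_ne_zero
    · intro h0
      refine hx g hg (LinearMap.ext fun b => ?_)
      rw [← polyEval_coord, h0, map_zero]
      rfl
  · by_contra hg1
    apply hb
    rw [map_prod]
    refine Finset.prod_eq_zero (Finset.mem_univ g) ?_
    simp [hg1, hx' g hg1 b hg]

theorem prod_map_X {σ : Type*} (s : Multiset σ) [DecidableEq σ] :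
    (s.map (MvPolynomial.X : σ → MvPolynomial σ ℂ)).prod =
      MvPolynomial.monomial (Multiset.toFinsupp s) 1 := by
  induction s using Multiset.induction_on with
  | empty => simp
  | cons i s ih =>
    rw [Multiset.map_cons, Multiset.prod_cons, ih, MvPolynomial.X, MvPolynomial.monomial_mul,
      ← Multiset.singleton_add, map_add, Multiset.toFinsupp_singleton, mul_one]

/-- Distinct monomials are linearly independent as functions, since `ℂ` is infinite. -/
theorem exists_sum_prod_ne_zero {σ : Type*} (T : Finset (Multiset σ)) (a : Multiset σ → ℂ)
    {s : Multiset σ} (hs : s ∈ T) (ha : a s ≠ 0) :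
    ∃ x : σ → ℂ, ∑ t ∈ T, a t * (t.map x).prod ≠ 0 := by
  classical
  by_contra! h
  have h0 : ∑ t ∈ T, MvPolynomial.C (a t) * (t.map MvPolynomial.X).prod =
      (0 : MvPolynomial σ ℂ) := by
    refine MvPolynomial.funext fun x => ?_
    rw [map_zero, ← h x, map_sum]
    refine Finset.sum_congr rfl fun t _ => ?_
    rw [map_mul, MvPolynomial.eval_C, map_multiset_prod, Multiset.map_map]
    simp
  have h1 := congrArg (MvPolynomial.coeff (Multiset.toFinsupp s)) h0
  simp only [prod_map_X, MvPolynomial.coeff_sum, MvPolynomial.coeff_C_mul,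
    MvPolynomial.coeff_monomial, EmbeddingLike.apply_eq_iff_eq, MvPolynomial.coeff_zero] at h1
  simp [hs, ha] at h1

/-- The elements `g y^a` of `H_c(G, V)`, where `y^a` is a monomial in the Dunkl operators. -/
def pbw (p : G × Multiset (Fin (Module.finrank ℂ V))) : Module.End ℂ (Poly V) :=
  (polyAct (p.1 : V ≃ₗ[ℂ] V)).toLinearMap * dunklMon c p.2

/-- A symbol argument. In a relation take a term `(g₀, s₀)` of top Dunkl degree and a point `b` with
trivial stabilizer where its coefficient is nonzero. Applying the relation to a test function
concentrated at `g₀⁻¹ b` and evaluating at `b` isolates the top symbol of the `g₀`-part, which is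
nonzero at a suitable covector `x`. -/
theorem linearIndependent_pbw : LinearIndependent (Poly V) (pbw c) := by
  classical
  rw [linearIndependent_iff]
  intro l hl
  by_contra hl0
  obtain ⟨⟨g₀, s₀⟩, hp₀, hmax⟩ := Finset.exists_max_image l.support (fun p => p.2.card)
    (Finsupp.support_nonempty_iff.2 hl0)
  obtain ⟨δ, hδ0, hδ⟩ := exists_regular G
  obtain ⟨b, hb⟩ : ∃ b, polyEval b (l (g₀, s₀) * δ) ≠ 0 := by
    by_contra! h
    exact mul_ne_zero (Finsupp.mem_support_iff.1 hp₀) hδ0 (eq_zero_of_polyEval h)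
  rw [map_mul, mul_ne_zero_iff] at hb
  have hreg := hδ b hb.2
  set T := (l.support.filter fun p => p.1 = g₀ ∧ p.2.card = s₀.card) with hT
  obtain ⟨x, hx⟩ := exists_sum_prod_ne_zero (T.image Prod.snd)
    (fun s => polyEval b (l (g₀, s))) (s := s₀)
    (Finset.mem_image.2 ⟨(g₀, s₀), by simpa [hT] using hp₀, rfl⟩) hb.1
  obtain ⟨q, u, hq, hu, hy⟩ := exists_test hreg g₀⁻¹ ((Module.finBasis ℂ V).constr ℂ x)
  have hq' : q * q - q ∈ orbitIdeal G b := by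
    rw [mem_orbitIdeal]
    intro g
    rw [map_sub, map_mul, hq]
    split_ifs <;> simp
  obtain ⟨N, hN, hN'⟩ := dunklMon_test c hreg hq' hu hy s₀.card 0
  -- The exponent is the top degree: terms of lower degree leave a positive power of `u`, which
  -- vanishes on the orbit, and terms with `g ≠ g₀` are killed by `q`.
  have h1 := congrArg (fun S => polyEval b (S (q * u ^ s₀.card))) hl
  simp only [Finsupp.linearCombination_apply, Finsupp.sum, LinearMap.sum_apply, map_sum,
    LinearMap.smul_apply, smul_eq_mul, map_mul, pbw, Module.End.mul_apply, AlgHom.toLinearMap_apply,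
    polyEval_polyAct, LinearMap.zero_apply, map_zero] at h1
  have h2 : ∀ p ∈ l.support, polyEval b (l p) * polyEval ((p.1 : V ≃ₗ[ℂ] V)⁻¹ b)
      (dunklMon c p.2 (q * u ^ s₀.card)) =
        if p.1 = g₀ ∧ p.2.card = s₀.card then
          N * (polyEval b (l (g₀, p.2)) * (p.2.map x).prod) else 0 := by
    rintro ⟨g, s⟩ hp
    have hle : s.card ≤ s₀.card := hmax _ hp
    obtain ⟨m, hm⟩ := Nat.exists_eq_add_of_le' hle
    have hval : ∀ f ∈ orbitIdeal G b, polyEval ((g : V ≃ₗ[ℂ] V)⁻¹ b) f = 0 :=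
      fun f hf => mem_orbitIdeal.1 hf g⁻¹
    have hqv : polyEval ((g : V ≃ₗ[ℂ] V)⁻¹ b) q = if g = g₀ then 1 else 0 := by
      rw [show (g : V ≃ₗ[ℂ] V)⁻¹ = ((g⁻¹ : G) : V ≃ₗ[ℂ] V) from rfl, hq]
      simp
    rcases Nat.eq_zero_or_pos m with rfl | hm0
    · have hs : s.card = s₀.card := by omega
      have h3 := hval _ (by simpa using hN' s hs)
      rw [map_sub, sub_eq_zero] at h3
      simp only [h3, map_smul, hqv, smul_eq_mul, hs, and_true]
      split_ifs with hg
      · subst hg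
        ring
      · simp
    · obtain ⟨N', -, h4⟩ := dunklMon_test c hreg hq' hu hy s.card m
      have h5 := hval _ (Ideal.pow_le_self (Nat.succ_ne_zero m) (h4 s rfl))
      rw [map_sub, sub_eq_zero, ← hm] at h5
      rw [h5, map_smul, map_mul, map_pow, hval u hu, zero_pow hm0.ne', if_neg (fun h => by
          have : s.card = s₀.card := h.2
          omega)]
      simp
  rw [Finset.sum_congr rfl h2, ← Finset.sum_filter, ← Finset.mul_sum] at h1
  apply hx
  rw [Finset.sum_image]
  · exact (mul_eq_zero.1 h1).resolve_left hN
  · rintro ⟨g, s⟩ hp ⟨g', s'⟩ hp' h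
    rw [Finset.mem_coe, hT, Finset.mem_filter] at hp hp'
    exact Prod.ext (hp.2.1.trans hp'.2.1.symm) h

/-- The commutation relations move functions to the left and Dunkl operators to the right, so the
left `ℂ[V]`-span is stable under left multiplication by each kind of generator. -/
theorem mul_mem_span_pbw {S T : Module.End ℂ (Poly V)} (hS : S ∈ rca c)
    (hT : T ∈ Submodule.span (Poly V) (Set.range (pbw c))) :
    S * T ∈ Submodule.span (Poly V) (Set.range (pbw c)) := by
  set U := Submodule.span (Poly V) (Set.range (pbw c)) with hU
  have hsmul : ∀ (z : ℂ) (T), T ∈ U → z • T ∈ U := by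
    intro z T hT
    have : z • T = algebraMap ℂ (Poly V) z • T := by
      ext f
      simp [Algebra.smul_def]
    rw [this]
    exact U.smul_mem _ hT
  have hG : ∀ (g : G), ∀ T ∈ U, (polyAct (g : V ≃ₗ[ℂ] V)).toLinearMap * T ∈ U := by
    intro g T hT
    induction hT using Submodule.span_induction with
    | mem T hT =>
      obtain ⟨⟨h, s⟩, rfl⟩ := hT
      refine Submodule.subset_span ⟨(g * h, s), ?_⟩
      ext f
      simp [pbw, polyAct_mul]
    | zero => simp
    | add T T' _ _ hT hT' => rw [mul_add]; exact add_mem hT hT'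
    | smul f T _ hT =>
      have : (polyAct (g : V ≃ₗ[ℂ] V)).toLinearMap * (f • T) =
          polyAct (g : V ≃ₗ[ℂ] V) f • ((polyAct (g : V ≃ₗ[ℂ] V)).toLinearMap * T) := by
        ext h
        simp
      rw [this]
      exact U.smul_mem _ hT
  have hY : ∀ (y : V), ∀ T ∈ U, dunkl c y * T ∈ U := by
    intro y T hT
    induction hT using Submodule.span_induction with
    | mem T hT =>
      obtain ⟨⟨g, s⟩, rfl⟩ := hT
      have h1 : dunkl c y * pbw c (g, s) = ∑ i,
          (Module.finBasis ℂ V).repr ((g : V ≃ₗ[ℂ] V)⁻¹ y) i • pbw c (g, i ::ₘ s) := by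
        have h2 : dunkl c ((g : V ≃ₗ[ℂ] V)⁻¹ y) = ∑ i,
            (Module.finBasis ℂ V).repr ((g : V ≃ₗ[ℂ] V)⁻¹ y) i •
              dunkl c (Module.finBasis ℂ V i) := by
          conv_lhs => rw [← (Module.finBasis ℂ V).sum_repr ((g : V ≃ₗ[ℂ] V)⁻¹ y)]
          rw [← dunklMap_apply, map_sum]
          simp only [map_smul, dunklMap_apply]
        have h3 : dunkl c y * pbw c (g, s) = (polyAct (g : V ≃ₗ[ℂ] V)).toLinearMap *
            (dunkl c ((g : V ≃ₗ[ℂ] V)⁻¹ y) * dunklMon c s) := by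
          ext f
          have h4 : (g : V ≃ₗ[ℂ] V) ((g : V ≃ₗ[ℂ] V)⁻¹ y) = y :=
            (g : V ≃ₗ[ℂ] V).apply_symm_apply y
          simp only [pbw, Module.End.mul_apply, AlgHom.toLinearMap_apply, polyAct_dunkl, h4]
        rw [h3, h2, Finset.sum_mul, Finset.mul_sum]
        refine Finset.sum_congr rfl fun i _ => ?_
        rw [smul_mul_assoc, mul_smul_comm, pbw, dunklMon_cons]
      rw [h1]
      exact sum_mem fun i _ => hsmul _ _ (Submodule.subset_span ⟨_, rfl⟩)
    | zero => simp
    | add T T' _ _ hT hT' => rw [mul_add]; exact add_mem hT hT'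
    | smul f T hTU hT =>
      have : dunkl c y * (f • T) = f • (dunkl c y * T) + (pderiv y f • T -
          ∑ r : Refl G, (c.val r * form r y) •
            (divDiff r f • ((polyAct (r.1 : V ≃ₗ[ℂ] V)).toLinearMap * T))) := by
        ext h
        simp [dunkl_mul, LinearMap.sum_apply]
      rw [this]
      exact add_mem (U.smul_mem _ hT) (sub_mem (U.smul_mem _ hTU)
        (sum_mem fun r _ => hsmul _ _ (U.smul_mem _ (hG r.1 T hTU))))
  induction hS using Algebra.adjoin_induction generalizing T with
  | mem S hS =>
    rcases hS with (⟨f, rfl⟩ | ⟨g, rfl⟩) | ⟨y, rfl⟩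
    · have : LinearMap.mulLeft ℂ f * T = f • T := by ext; simp
      rw [this]
      exact U.smul_mem _ hT
    · exact hG g T hT
    · exact hY y T hT
  | algebraMap z =>
    rw [← Algebra.smul_def]
    exact hsmul z T hT
  | add S S' _ _ hS hS' => rw [add_mul]; exact add_mem (hS hT) (hS' hT)
  | mul S S' _ _ hS hS' => rw [mul_assoc]; exact hS (hS' hT)

theorem mem_span_pbw {S : Module.End ℂ (Poly V)} (hS : S ∈ rca c) :
    S ∈ Submodule.span (Poly V) (Set.range (pbw c)) := by
  rw [← mul_one S]
  refine mul_mem_span_pbw c hS (Submodule.subset_span ⟨(1, 0), ?_⟩)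
  ext f
  simp [pbw, polyAct_one]

end PBW

/-! ### Relations and PBW coordinates inside `H_c`. -/

section Algebra

variable {V : Type*} [AddCommGroup V] [Module ℂ V] {G : Subgroup (V ≃ₗ[ℂ] V)} [Finite G]
  (c : Param G)

/-- The defining faithful action of `H_c(G, V)` on `ℂ[V]`. -/
def toEnd : RCA c →ₐ[ℂ] Module.End ℂ (Poly V) := (rca c).val

theorem toEnd_injective : Function.Injective (toEnd c) := Subtype.val_injective

theorem toEnd_mem (h : RCA c) : toEnd c h ∈ rca c := Subtype.property h

/-- A multiplication operator, in `H_c(G, V)`. -/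
def mulElt : Poly V →ₐ[ℂ] RCA c :=
  (Algebra.lmul ℂ (Poly V)).codRestrict (rca c)
    fun f => Algebra.subset_adjoin (Or.inl (Or.inl ⟨f, rfl⟩))

@[simp]
theorem toEnd_mulElt (f h : Poly V) : toEnd c (mulElt c f) h = f * h := rfl

@[simp]
theorem toEnd_groupElt (g : G) (h : Poly V) :
    toEnd c (groupElt c g) h = polyAct (g : V ≃ₗ[ℂ] V) h := rfl

@[simp]
theorem toEnd_dunklElt (y : V) : toEnd c (dunklElt c y) = dunkl c y := rfl

/-- The inclusion of `G` into `H_c(G, V)`. -/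
def groupHom : G →* RCA c where
  toFun := groupElt c
  map_one' := toEnd_injective c (LinearMap.ext fun f => by simp [polyAct_one])
  map_mul' g h := toEnd_injective c (LinearMap.ext fun f => by simp [polyAct_mul])

theorem groupElt_mul (g h : G) : groupElt c (g * h) = groupElt c g * groupElt c h :=
  map_mul (groupHom c) g h

theorem groupElt_one : groupElt c 1 = 1 := map_one (groupHom c)

theorem groupElt_mul_mulElt (g : G) (f : Poly V) :
    groupElt c g * mulElt c f = mulElt c (polyAct (g : V ≃ₗ[ℂ] V) f) * groupElt c g :=
  toEnd_injective c (LinearMap.ext fun h => by simp)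

theorem dunklElt_mul_groupElt (g : G) (y : V) :
    dunklElt c y * groupElt c g = groupElt c g * dunklElt c ((g : V ≃ₗ[ℂ] V)⁻¹ y) := by
  refine toEnd_injective c (LinearMap.ext fun h => ?_)
  have h4 : (g : V ≃ₗ[ℂ] V) ((g : V ≃ₗ[ℂ] V)⁻¹ y) = y := (g : V ≃ₗ[ℂ] V).apply_symm_apply y
  simp only [map_mul, Module.End.mul_apply, toEnd_groupElt, toEnd_dunklElt, polyAct_dunkl, h4]

theorem dunklElt_mul_mulElt (y : V) (f : Poly V) :
    dunklElt c y * mulElt c f = mulElt c f * dunklElt c y + (mulElt c (pderiv y f) -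
      ∑ r : Refl G, (c.val r * form r y) • (mulElt c (divDiff r f) * groupElt c r.1)) :=
  toEnd_injective c (LinearMap.ext fun h => by simp [dunkl_mul, LinearMap.sum_apply])

variable [FiniteDimensional ℂ V]

/-- The Euler element of `H_c(G, V)`. -/
def eulerElt : RCA c :=
  ∑ i, mulElt c (coord ((Module.finBasis ℂ V).coord i)) * dunklElt c (Module.finBasis ℂ V i) +
    ∑ r : Refl G, c.val r • (1 - groupElt c r.1)

/-- The term `∑ c_r (1 - r)` cancels the divided differences, so commutators with the Euler element
measure degree. -/
theorem toEnd_eulerElt : toEnd c (eulerElt c) = euler V := by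
  ext f
  rw [← sum_coord_mul_dunkl c f]
  simp [eulerElt, LinearMap.sum_apply]

theorem eulerElt_mul_mulElt {d : ℕ} {f : Poly V} (hf : f ∈ homog V d) :
    eulerElt c * mulElt c f = mulElt c f * eulerElt c + (d : ℂ) • mulElt c f :=
  toEnd_injective c (LinearMap.ext fun h => by
    simp only [map_mul, map_add, map_smul, toEnd_eulerElt, Module.End.mul_apply, toEnd_mulElt,
      LinearMap.add_apply, LinearMap.smul_apply, euler_mul, euler_eq hf, smul_mul_assoc])

theorem dunklMon_mem (s : Multiset (Fin (Module.finrank ℂ V))) : dunklMon c s ∈ rca c := by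
  induction s using Multiset.induction_on with
  | empty => simp
  | cons i s ih =>
    rw [dunklMon_cons]
    exact mul_mem (toEnd_mem c (dunklElt c _)) ih

/-- A monomial in the Dunkl operators of a basis, in `H_c(G, V)`. -/
def monElt (s : Multiset (Fin (Module.finrank ℂ V))) : RCA c := ⟨dunklMon c s, dunklMon_mem c s⟩

@[simp]
theorem toEnd_monElt (s : Multiset (Fin (Module.finrank ℂ V))) :
    toEnd c (monElt c s) = dunklMon c s := rfl

theorem monElt_zero : monElt c 0 = 1 := toEnd_injective c (by simp)

theorem monElt_cons (i : Fin (Module.finrank ℂ V)) (s : Multiset (Fin (Module.finrank ℂ V))) :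
    monElt c (i ::ₘ s) = monElt c s * dunklElt c (Module.finBasis ℂ V i) :=
  toEnd_injective c (by simp [dunklMon_cons'])

theorem toEnd_pbw (f : Poly V) (g : G) (s : Multiset (Fin (Module.finrank ℂ V))) :
    toEnd c (mulElt c f * groupElt c g * monElt c s) = f • pbw c (g, s) := by
  ext h
  simp [pbw]

theorem rca_induction {motive : RCA c → Prop}
    (pbw : ∀ f g s, motive (mulElt c f * groupElt c g * monElt c s))
    (add : ∀ a b, motive a → motive b → motive (a + b)) (h : RCA c) : motive h := by
  obtain ⟨l, hl⟩ := (Finsupp.mem_span_range_iff_exists_finsupp).1 (mem_span_pbw c (toEnd_mem c h))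
  have : h = ∑ p ∈ l.support, mulElt c (l p) * groupElt c p.1 * monElt c p.2 := by
    apply toEnd_injective c
    simp only [← hl, map_sum, toEnd_pbw, Finsupp.sum]
  rw [this]
  exact Finset.sum_induction _ _ add (by simpa using pbw 0 1 0) fun p _ => pbw _ _ _

/-- The coordinates of an element of `H_c(G, V)` with respect to the basis `g y^a` over
`ℂ[V]`. -/
def pbwCoord : RCA c →ₗ[ℂ] (G × Multiset (Fin (Module.finrank ℂ V))) →₀ Poly V where
  toFun h := (linearIndependent_pbw c).repr ⟨toEnd c h, mem_span_pbw c (toEnd_mem c h)⟩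
  map_add' a b := by
    rw [← map_add]
    congr 1
  map_smul' z a := by
    have h (l : (G × Multiset (Fin (Module.finrank ℂ V))) →₀ Poly V) :
        z • l = algebraMap ℂ (Poly V) z • l := by
      ext p
      simp [Algebra.smul_def]
    rw [RingHom.id_apply, h, ← map_smul]
    congr 1

theorem pbwCoord_pbw (f : Poly V) (g : G) (s : Multiset (Fin (Module.finrank ℂ V))) :
    pbwCoord c (mulElt c f * groupElt c g * monElt c s) = Finsupp.single (g, s) f := by
  apply (linearIndependent_pbw c).repr_eq
  rw [Finsupp.linearCombination_single]
  exact (toEnd_pbw c f g s).symm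

end Algebra

/-! ### The standard module and its fibre at a point. -/

section Standard

variable {V : Type*} [AddCommGroup V] [Module ℂ V] {G : Subgroup (V ≃ₗ[ℂ] V)} [Finite G]
  (c : Param G) {W : Type*} [AddCommGroup W] [Module ℂ W] (ρ : Representation ℂ G W)

/-- The element `f ⊗ u` of `Δ_c(W)`. -/
def vec : Poly V →ₗ[ℂ] W →ₗ[ℂ] Standard c ρ :=
  LinearMap.mk₂ ℂ (fun f u => (standardRel c ρ).mkQ (mulElt c f ⊗ₜ[ℂ] u))
    (fun f f' u => by rw [map_add, TensorProduct.add_tmul, map_add])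
    (fun z f u => by
      rw [map_smul, ← TensorProduct.smul_tmul']
      rfl)
    (fun f u u' => by rw [TensorProduct.tmul_add, map_add])
    (fun z f u => by
      rw [TensorProduct.tmul_smul]
      rfl)

theorem vec_apply (f : Poly V) (u : W) :
    vec c ρ f u = (standardRel c ρ).mkQ (mulElt c f ⊗ₜ[ℂ] u) := rfl

theorem smul_vec_one (h : RCA c) (u : W) :
    h • vec c ρ 1 u = (standardRel c ρ).mkQ (h ⊗ₜ[ℂ] u) := by
  rw [vec_apply, ← map_smul, map_one, TensorProduct.smul_tmul', smul_eq_mul, mul_one]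

theorem mulElt_smul_vec (f h : Poly V) (u : W) :
    mulElt c f • vec c ρ h u = vec c ρ (f * h) u := by
  rw [vec_apply, vec_apply, ← map_smul, map_mul, TensorProduct.smul_tmul', smul_eq_mul]

theorem mulElt_smul_vec_one (f : Poly V) (u : W) :
    mulElt c f • vec c ρ 1 u = vec c ρ f u := by
  rw [mulElt_smul_vec, mul_one]

theorem groupElt_smul_vec_one (g : G) (u : W) :
    groupElt c g • vec c ρ 1 u = vec c ρ 1 (ρ g u) := by
  rw [smul_vec_one, vec_apply, map_one, ← sub_eq_zero, ← map_sub]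
  exact (Submodule.Quotient.mk_eq_zero _).2 (Submodule.subset_span (Or.inl ⟨g, u, rfl⟩))

theorem dunklElt_smul_vec_one (y : V) (u : W) : dunklElt c y • vec c ρ 1 u = 0 := by
  rw [smul_vec_one]
  exact (Submodule.Quotient.mk_eq_zero _).2 (Submodule.subset_span (Or.inr ⟨y, u, rfl⟩))

theorem groupElt_smul_vec (g : G) (f : Poly V) (u : W) :
    groupElt c g • vec c ρ f u = vec c ρ (polyAct (g : V ≃ₗ[ℂ] V) f) (ρ g u) := by
  rw [← mulElt_smul_vec_one, smul_smul, groupElt_mul_mulElt, mul_smul, groupElt_smul_vec_one,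
    mulElt_smul_vec_one]

theorem dunklElt_smul_vec (y : V) (f : Poly V) (u : W) :
    dunklElt c y • vec c ρ f u = vec c ρ (pderiv y f) u -
      ∑ r : Refl G, (c.val r * form r y) • vec c ρ (divDiff r f) (ρ r.1 u) := by
  rw [← mulElt_smul_vec_one, smul_smul, dunklElt_mul_mulElt, add_smul, mul_smul,
    dunklElt_smul_vec_one, smul_zero, zero_add, sub_smul, mulElt_smul_vec_one, Finset.sum_smul]
  congr 1
  refine Finset.sum_congr rfl fun r _ => ?_
  rw [smul_assoc, mul_smul (mulElt c _), groupElt_smul_vec_one, mulElt_smul_vec_one]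

theorem submodule_eq_top_of_vec_one {N : Submodule (RCA c) (Standard c ρ)}
    (hN : ∀ u, vec c ρ 1 u ∈ N) : N = ⊤ := by
  rw [eq_top_iff]
  rintro m -
  obtain ⟨t, rfl⟩ := (standardRel c ρ).mkQ_surjective m
  induction t using TensorProduct.induction_on with
  | zero => simp
  | tmul h u =>
    rw [← smul_vec_one]
    exact N.smul_mem h (hN u)
  | add t t' ht ht' =>
    rw [map_add]
    exact N.add_mem ht ht'

variable [FiniteDimensional ℂ V]

theorem eulerElt_smul_vec {d : ℕ} {f : Poly V} (hf : f ∈ homog V d) (u : W) :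
    eulerElt c • vec c ρ f u = vec c ρ f (reflSum c ρ u) + (d : ℂ) • vec c ρ f u := by
  have h1 : eulerElt c • vec c ρ 1 u = vec c ρ 1 (reflSum c ρ u) := by
    simp only [eulerElt, add_smul, Finset.sum_smul, mul_smul, dunklElt_smul_vec_one, smul_zero,
      Finset.sum_const_zero, zero_add, smul_assoc, sub_smul, one_smul, groupElt_smul_vec_one,
      reflSum, LinearMap.sum_apply, map_sum, LinearMap.smul_apply, map_smul, LinearMap.sub_apply,
      map_sub, Module.End.one_apply]
  rw [← mulElt_smul_vec_one, smul_smul, eulerElt_mul_mulElt c hf, add_smul, mul_smul, h1,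
    smul_assoc, mulElt_smul_vec_one, mulElt_smul_vec_one]

open Classical in
/-- The map `∑ f_{g,a} g y^a ↦ ∑ f_{g,0}(v) g` with values in the operators on `W`. -/
def evalCoeff (v : V) : RCA c →ₗ[ℂ] Module.End ℂ W :=
  Finsupp.lsum ℂ (fun p : G × Multiset (Fin (Module.finrank ℂ V)) =>
    if p.2 = 0 then (polyEval v).toLinearMap.smulRight (ρ p.1) else 0) ∘ₗ pbwCoord c

open Classical in
theorem evalCoeff_pbw (v : V) (f : Poly V) (g : G) (s : Multiset (Fin (Module.finrank ℂ V))) :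
    evalCoeff c ρ v (mulElt c f * groupElt c g * monElt c s) =
      if s = 0 then polyEval v f • ρ g else 0 := by
  rw [evalCoeff, LinearMap.comp_apply, pbwCoord_pbw, Finsupp.lsum_single]
  split_ifs <;> simp

theorem evalCoeff_mulElt (v : V) (f : Poly V) :
    evalCoeff c ρ v (mulElt c f) = polyEval v f • 1 := by
  have := evalCoeff_pbw c ρ v f 1 0
  rwa [groupElt_one, monElt_zero, mul_one, mul_one, if_pos rfl, map_one] at this

/-- Right multiplication by a basis Dunkl operator raises the exponent of `y^a`, so no term with `a
= 0` survives. -/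
theorem evalCoeff_mul_dunklElt (v : V) (h : RCA c) (y : V) :
    evalCoeff c ρ v (h * dunklElt c y) = 0 := by
  have key : ∀ i, evalCoeff c ρ v (h * dunklElt c (Module.finBasis ℂ V i)) = 0 := by
    intro i
    induction h using rca_induction with
    | pbw f g s =>
      rw [mul_assoc, ← monElt_cons, evalCoeff_pbw, if_neg (Multiset.cons_ne_zero)]
    | add a b ha hb => rw [add_mul, map_add, ha, hb, add_zero]
  have h2 : dunklElt c y = ∑ i, (Module.finBasis ℂ V).repr y i •
      dunklElt c (Module.finBasis ℂ V i) := by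
    apply toEnd_injective c
    simp only [map_sum, map_smul, toEnd_dunklElt]
    conv_lhs => rw [← (Module.finBasis ℂ V).sum_repr y]
    rw [← dunklMap_apply, map_sum]
    simp only [map_smul, dunklMap_apply]
  rw [h2, Finset.mul_sum, map_sum]
  refine Finset.sum_eq_zero fun i _ => ?_
  rw [mul_smul_comm, map_smul, key, smul_zero]

theorem evalCoeff_mul_groupElt (v : V) (h : RCA c) (g : G) :
    evalCoeff c ρ v (h * groupElt c g) = evalCoeff c ρ v h * ρ g := by
  induction h using rca_induction with
  | pbw f k s =>
    induction s using Multiset.induction_on with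
    | empty =>
      have := evalCoeff_pbw c ρ v f (k * g) 0
      rw [monElt_zero, mul_one, groupElt_mul, ← mul_assoc, if_pos rfl] at this
      rw [evalCoeff_pbw, if_pos rfl, monElt_zero, mul_one, this, map_mul, smul_mul_assoc]
    | cons i s _ =>
      rw [evalCoeff_pbw, if_neg Multiset.cons_ne_zero, zero_mul, monElt_cons, ← mul_assoc,
        mul_assoc _ (dunklElt c _), dunklElt_mul_groupElt, ← mul_assoc, evalCoeff_mul_dunklElt]
  | add a b ha hb => rw [add_mul, map_add, map_add, ha, hb, add_mul]

/-- The pairing `h ⊗ u ↦ h(v) u` on `H_c(G, V) ⊗ W`. -/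
def evalTensor (v : V) : RCA c ⊗[ℂ] W →ₗ[ℂ] W := TensorProduct.lift (evalCoeff c ρ v)

/-- The pairing is not `H_c`-linear, so the relations must be tested after multiplication by every
`h`. -/
theorem evalTensor_smul_eq_zero (v : V) {t : RCA c ⊗[ℂ] W} (ht : t ∈ standardRel c ρ)
    (h : RCA c) : evalTensor c ρ v (h • t) = 0 := by
  induction ht using Submodule.span_induction generalizing h with
  | mem t ht =>
    rcases ht with ⟨g, u, rfl⟩ | ⟨y, u, rfl⟩
    · rw [smul_sub, TensorProduct.smul_tmul', TensorProduct.smul_tmul', map_sub, evalTensor,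
        TensorProduct.lift.tmul, TensorProduct.lift.tmul, smul_eq_mul, smul_eq_mul, mul_one,
        evalCoeff_mul_groupElt, Module.End.mul_apply, sub_self]
    · rw [TensorProduct.smul_tmul', evalTensor, TensorProduct.lift.tmul, smul_eq_mul,
        evalCoeff_mul_dunklElt, LinearMap.zero_apply]
  | zero => simp
  | add t t' _ _ ht ht' => rw [smul_add, map_add, ht, ht', add_zero]
  | smul k t _ ht => rw [smul_smul, ht]

/-- The fibre of `Δ_c(W)` at `v`: the map `f ⊗ u ↦ f(v) u`. -/
def evalStd (v : V) : Standard c ρ →ₗ[ℂ] W :=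
  ((standardRel c ρ).restrictScalars ℂ).liftQ (evalTensor c ρ v)
    (fun t ht => by simpa using evalTensor_smul_eq_zero c ρ v ht 1) ∘ₗ
      (Submodule.Quotient.restrictScalarsEquiv ℂ (standardRel c ρ)).symm.toLinearMap

theorem evalStd_vec (v : V) (f : Poly V) (u : W) :
    evalStd c ρ v (vec c ρ f u) = polyEval v f • u := by
  change TensorProduct.lift (evalCoeff c ρ v) (mulElt c f ⊗ₜ[ℂ] u) = _
  rw [TensorProduct.lift.tmul, evalCoeff_mulElt]
  simp

/-- Evaluation shows that the standard module is nonzero; being finitely generated, it has a maximal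
submodule, which contains the radical. -/
theorem jacobson_ne_top [FiniteDimensional ℂ W] [Nontrivial W] :
    Module.jacobson (RCA c) (Standard c ρ) ≠ ⊤ := by
  have : Nontrivial (Standard c ρ) := by
    obtain ⟨u, hu⟩ := exists_ne (0 : W)
    refine ⟨vec c ρ 1 u, 0, fun h => hu ?_⟩
    have := evalStd_vec c ρ 0 1 u
    rwa [h, map_zero, map_one, one_smul, eq_comm] at this
  obtain ⟨N, hN⟩ := IsCoatomic.exists_coatom (Submodule (RCA c) (Standard c ρ))
  exact fun h => hN.1 (top_le_iff.1 (h ▸ sInf_le hN))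

end Standard

/-! ### Serre classes of representations, in terms of linear maps. -/

section SerreClasses

variable {K : Type*} [Group K] {P : ObjectProperty (FDRep ℂ K)} [P.IsSerreClass]

/-- The morphism of finite dimensional representations given by an equivariant linear map. -/
def homOfLinear {X Y : FDRep ℂ K} (f : X →ₗ[ℂ] Y) (hf : ∀ g x, f (X.ρ g x) = Y.ρ g (f x)) :
    X ⟶ Y where
  hom := FGModuleCat.ofHom f
  comm g := by
    ext x
    exact hf g x

theorem prop_of_surjective {X Y : FDRep ℂ K} (f : X →ₗ[ℂ] Y)
    (hf : ∀ g x, f (X.ρ g x) = Y.ρ g (f x)) (hs : Function.Surjective f) (hX : P X) : P Y := by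
  have : Epi (homOfLinear f hf) := ConcreteCategory.epi_of_surjective _ hs
  exact P.prop_of_epi (homOfLinear f hf) hX

variable {U U' U'' : Type} [AddCommGroup U] [Module ℂ U] [FiniteDimensional ℂ U]
  [AddCommGroup U'] [Module ℂ U'] [FiniteDimensional ℂ U']
  [AddCommGroup U''] [Module ℂ U''] [FiniteDimensional ℂ U'']

theorem prop_of_exact (σ : Representation ℂ K U) (σ' : Representation ℂ K U')
    (σ'' : Representation ℂ K U'') (f : U →ₗ[ℂ] U') (hf : ∀ g x, f (σ g x) = σ' g (f x))
    (e : U' →ₗ[ℂ] U'') (he : ∀ g y, e (σ' g y) = σ'' g (e y))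
    (h : LinearMap.range f = LinearMap.ker e)
    (hX : P (FDRep.of σ)) (hZ : P (FDRep.of σ'')) : P (FDRep.of σ') := by
  let S : ShortComplex (FDRep ℂ K) := ShortComplex.mk
    (homOfLinear (X := FDRep.of σ) (Y := FDRep.of σ') f hf)
    (homOfLinear (X := FDRep.of σ') (Y := FDRep.of σ'') e he) (by
      ext x
      exact LinearMap.mem_ker.1 (h.le ⟨x, rfl⟩))
  refine P.prop_X₂_of_exact (S := S) ?_ hX hZ
  rw [← S.exact_map_iff_of_faithful
    (Action.forget (FGModuleCat ℂ) K ⋙ forget₂ (FGModuleCat ℂ) (ModuleCat ℂ)),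
    ShortComplex.moduleCat_exact_iff_range_eq_ker]
  exact h

theorem prop_of_extension (σ : Representation ℂ K U) (A : Submodule ℂ U)
    (hA : ∀ g, A ≤ A.comap (σ g)) (h₁ : P (FDRep.of (σ.subrepresentation A hA)))
    (h₂ : P (FDRep.of (σ.quotient A hA))) : P (FDRep.of σ) :=
  prop_of_exact (σ.subrepresentation A hA) σ (σ.quotient A hA) A.subtype (fun _ _ => rfl) A.mkQ
    (fun _ _ => rfl) (A.range_subtype.trans A.ker_mkQ.symm) h₁ h₂

theorem prop_of_subsingleton [Subsingleton U] (σ : Representation ℂ K U) : P (FDRep.of σ) := by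
  apply P.prop_of_isZero
  rw [Limits.IsZero.iff_id_eq_zero]
  ext x
  exact Subsingleton.elim (α := U) _ _

end SerreClasses

section ReflectionSum

variable {V : Type*} [AddCommGroup V] [Module ℂ V] {G : Subgroup (V ≃ₗ[ℂ] V)} [Finite G]
  (c : Param G)

theorem map_reflSum {T T' : Type*} [AddCommGroup T] [Module ℂ T] [AddCommGroup T'] [Module ℂ T']
    (τ : Representation ℂ G T) (τ' : Representation ℂ G T') (φ : T →ₗ[ℂ] T')
    (hφ : ∀ g t, φ (τ g t) = τ' g (φ t)) (t : T) :
    φ (reflSum c τ t) = reflSum c τ' (φ t) := by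
  simp [reflSum, LinearMap.sum_apply, hφ]

theorem cValue_eq {W : Type*} [AddCommGroup W] [Module ℂ W] [FiniteDimensional ℂ W]
    [Nontrivial W] (ρ : Representation ℂ G W) (hρ : ρ.IsIrreducible) {κ : ℂ}
    (h : ∀ u, reflSum c ρ u = κ • u) : cValue c ρ hρ = κ := by
  obtain ⟨u, hu⟩ := exists_ne (0 : W)
  have h1 := h u
  rw [cValue_spec c ρ hρ] at h1
  exact smul_left_injective ℂ hu h1

end ReflectionSum

/-! ### Transport of irreducible representations. -/

section Transport

variable {G : Type*} [Group G] {T T' : Type*} [AddCommGroup T] [Module ℂ T] [AddCommGroup T']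
  [Module ℂ T']

/-- Transport of a representation along a linear equivalence. -/
def transport (τ : Representation ℂ G T) (e : T ≃ₗ[ℂ] T') : Representation ℂ G T' where
  toFun g := e.conj (τ g)
  map_one' := by ext; simp
  map_mul' g h := by ext; simp [LinearEquiv.conj_apply]

theorem transport_apply (τ : Representation ℂ G T) (e : T ≃ₗ[ℂ] T') (g : G) (t : T) :
    transport τ e g (e t) = e (τ g t) := by
  simp [transport, LinearEquiv.conj_apply]

theorem transport_isIrreducible {τ : Representation ℂ G T} (hτ : τ.IsIrreducible)
    (e : T ≃ₗ[ℂ] T') : (transport τ e).IsIrreducible := by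
  let f : Subrepresentation (transport τ e) ≃o Subrepresentation τ :=
    { toFun := fun S => ⟨S.toSubmodule.comap e.toLinearMap, fun g t ht => by
        have := S.apply_mem_toSubmodule g ht
        simpa [transport_apply] using this⟩
      invFun := fun S => ⟨S.toSubmodule.comap e.symm.toLinearMap, fun g t ht => by
        have := S.apply_mem_toSubmodule g ht
        obtain ⟨t, rfl⟩ := e.surjective t
        simpa [transport_apply] using this⟩
      left_inv := fun S => by
        ext t
        simp
      right_inv := fun S => by
        ext t
        simp
      map_rel_iff' := by
        intro S S'
        constructor
        · intro h t ht
          obtain ⟨t, rfl⟩ := e.surjective t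
          exact @h t ht
        · intro h t ht
          exact h ht }
  exact f.isSimpleOrder

theorem nontrivial_of_isIrreducible {τ : Representation ℂ G T} (hτ : τ.IsIrreducible) :
    Nontrivial T := by
  by_contra h
  rw [not_nontrivial_iff_subsingleton] at h
  exact bot_ne_top (α := Subrepresentation τ)
    (Subrepresentation.toSubmodule_injective (Subsingleton.elim _ _))

end Transport

/-! ### Representations on which `∑ c_r (1 - r)` is scalar, and extensions by them. -/

section SerreClasses

variable {V : Type*} [AddCommGroup V] [Module ℂ V] {G : Subgroup (V ≃ₗ[ℂ] V)} [Finite G]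
  (c : Param G) {H : Subgroup G} {P : ObjectProperty (FDRep ℂ H)} [P.IsSerreClass]

/-- If `P` contains the restrictions of the irreducible representations on which
`∑_r c_r (1 - r)` acts by `κ`, then it contains the quotients of the restriction of every
representation on which `∑_r c_r (1 - r)` acts by `κ`. -/
theorem prop_of_reflSum_eq {κ : ℂ}
    (hP : ∀ (X : FDRep ℂ G) (hX : Representation.IsIrreducible X.ρ), cValue c X.ρ hX = κ → P (res H X))
    {T : Type*} [AddCommGroup T] [Module ℂ T] [FiniteDimensional ℂ T]
    (τ : Representation ℂ G T) (hτ : ∀ t, reflSum c τ t = κ • t)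
    {U : Type} [AddCommGroup U] [Module ℂ U] [FiniteDimensional ℂ U] (σ : Representation ℂ H U)
    (f : T →ₗ[ℂ] U) (hf : ∀ (h : H) t, f (τ h t) = σ h (f t)) (hs : Function.Surjective f) :
    P (FDRep.of σ) := by
  induction hn : Module.finrank ℂ T using Nat.strong_induction_on generalizing T U with
  | _ n ih =>
  by_cases hT : Subsingleton T
  · have : Subsingleton U := hs.subsingleton
    exact prop_of_subsingleton σ
  rw [not_subsingleton_iff_nontrivial] at hT
  by_cases hirr : τ.IsIrreducible
  -- `T` may live in any universe, whereas `hP` speaks of objects of `FDRep ℂ G`; a model on `Fin n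
  -- → ℂ` bridges the two.
  · let e := (Module.finBasis ℂ T).equivFun
    have : Nontrivial (Fin (Module.finrank ℂ T) → ℂ) := e.symm.toEquiv.nontrivial
    have h1 := hP (FDRep.of (transport τ e)) (transport_isIrreducible hirr e)
      (cValue_eq c _ _ fun t => by
        obtain ⟨t, rfl⟩ := e.surjective t
        have := map_reflSum c τ (transport τ e) e.toLinearMap
          (fun g t => (transport_apply τ e g t).symm) t
        rw [hτ, map_smul] at this
        exact this.symm)
    refine prop_of_surjective (X := res H (FDRep.of (transport τ e))) (Y := FDRep.of σ)
      (f ∘ₗ e.symm.toLinearMap) (fun g x => ?_) (hs.comp e.symm.surjective) h1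
    obtain ⟨t, rfl⟩ := e.surjective x
    change f (e.symm (transport τ e g (e t))) = σ g (f (e.symm (e t)))
    rw [transport_apply, e.symm_apply_apply, e.symm_apply_apply, hf]
  · obtain ⟨S, hS0, hS1⟩ : ∃ S : Subrepresentation τ, S ≠ ⊥ ∧ S ≠ ⊤ := by
      by_contra! h
      have : Nontrivial (Subrepresentation τ) :=
        ⟨⊥, ⊤, fun h => bot_ne_top (α := Submodule ℂ T)
          (congrArg Subrepresentation.toSubmodule h)⟩
      exact hirr ⟨fun S => or_iff_not_imp_left.2 (h S)⟩
    obtain ⟨S, hinv⟩ := S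
    have hS0' : S ≠ ⊥ := fun h => hS0 (Subrepresentation.toSubmodule_injective h)
    have hS1' : S ≠ ⊤ := fun h => hS1 (Subrepresentation.toSubmodule_injective h)
    have hUinv : ∀ h, S.map f ≤ (S.map f).comap (σ h) := by
      rintro h _ ⟨t, ht, rfl⟩
      exact ⟨τ h t, hinv h ht, hf h t⟩
    -- `S` surjects onto `f(S)` and `T / S` onto `U / f(S)`; both sources have smaller dimension and
    -- the same scalar.
    refine prop_of_extension σ (S.map f) hUinv ?_ ?_
    · refine ih _ (hn ▸ Submodule.finrank_lt hS1')
        (τ.subrepresentation S hinv) (fun t => ?_) _ (f.submoduleMap S) (fun h t => ?_)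
        (f.submoduleMap_surjective S) rfl
      · apply Subtype.ext
        have := map_reflSum c (τ.subrepresentation S hinv) τ S.subtype (fun g t => rfl) t
        rw [hτ] at this
        exact this
      · exact Subtype.ext (hf h t)
    · have hlt : Module.finrank ℂ (T ⧸ S) < n := by
        have h1 := S.finrank_quotient_add_finrank
        have h2 := Submodule.one_le_finrank_iff.2 hS0'
        omega
      refine ih _ hlt (τ.quotient S hinv) (fun t => ?_) _
        (S.mapQ (S.map f) f (Submodule.map_le_iff_le_comap.1 le_rfl)) (fun h t => ?_) ?_ rfl
      · obtain ⟨t, rfl⟩ := S.mkQ_surjective t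
        have := map_reflSum c τ (τ.quotient S hinv) S.mkQ (fun g t => rfl) t
        rw [hτ, map_smul] at this
        exact this.symm
      · obtain ⟨t, rfl⟩ := S.mkQ_surjective t
        exact congrArg (S.map f).mkQ (hf h t)
      · intro y
        obtain ⟨y, rfl⟩ := (S.map f).mkQ_surjective y
        obtain ⟨t, rfl⟩ := hs y
        exact ⟨S.mkQ t, rfl⟩

variable {U : Type} [AddCommGroup U] [Module ℂ U] [FiniteDimensional ℂ U]

/-- The submodule `A` is preserved by `H` and, as a representation of `H`, belongs to `P`. -/
def InClass (P : ObjectProperty (FDRep ℂ H)) (σ : Representation ℂ H U) (A : Submodule ℂ U) :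
    Prop :=
  ∃ hA : ∀ h, A ≤ A.comap (σ h), P (FDRep.of (σ.subrepresentation A hA))

/-- The new subspace is an extension of the range of `f`, a quotient of the restriction of `T`, by
`A`. Equivariance of `f` is phrased with representatives because the action on `U ⧸ A` depends on
the invariance proof inside `hA`. -/
theorem inClass_comap_mkQ {κ : ℂ}
    (hP : ∀ (X : FDRep ℂ G) (hX : Representation.IsIrreducible X.ρ),
      cValue c X.ρ hX = κ → P (res H X))
    {T : Type*} [AddCommGroup T] [Module ℂ T] [FiniteDimensional ℂ T]
    (τ : Representation ℂ G T) (hτ : ∀ t, reflSum c τ t = κ • t) {σ : Representation ℂ H U}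
    {A : Submodule ℂ U} (hA : InClass P σ A) (f : T →ₗ[ℂ] U ⧸ A)
    (hf : ∀ (h : H) t x, f t = A.mkQ x → f (τ h t) = A.mkQ (σ h x)) :
    InClass P σ ((LinearMap.range f).comap A.mkQ) := by
  obtain ⟨hAinv, hPA⟩ := hA
  have hinv : ∀ h, (LinearMap.range f).comap A.mkQ ≤
      ((LinearMap.range f).comap A.mkQ).comap (σ h) := by
    rintro h x ⟨t, ht⟩
    exact ⟨τ h t, hf h t x ht⟩
  have hf' : ∀ (h : H) t, f (τ h t) = (σ.quotient A hAinv) h (f t) := by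
    intro h t
    obtain ⟨x, hx⟩ := A.mkQ_surjective (f t)
    rw [hf h t x hx.symm, ← hx]
    rfl
  have hrinv : ∀ h, LinearMap.range f ≤
      (LinearMap.range f).comap ((σ.quotient A hAinv) h) := by
    rintro h _ ⟨t, rfl⟩
    exact ⟨τ h t, hf' h t⟩
  have hZ := prop_of_reflSum_eq c hP τ hτ
    ((σ.quotient A hAinv).subrepresentation (LinearMap.range f) hrinv) f.rangeRestrict
    (fun h t => Subtype.ext (hf' h t)) f.surjective_rangeRestrict
  have hle : A ≤ (LinearMap.range f).comap A.mkQ := by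
    intro x hx
    have : A.mkQ x = 0 := (Submodule.Quotient.mk_eq_zero A).2 hx
    rw [Submodule.mem_comap, this]
    exact zero_mem _
  have hmem : ∀ x : (LinearMap.range f).comap A.mkQ,
      (A.mkQ ∘ₗ Submodule.subtype _) x ∈ LinearMap.range f := fun x => x.2
  refine ⟨hinv, prop_of_exact (σ.subrepresentation A hAinv) _ _
    (Submodule.inclusion hle) (fun _ _ => rfl)
    ((A.mkQ ∘ₗ Submodule.subtype _).codRestrict (LinearMap.range f) hmem)
    (fun _ _ => rfl) ?_ hPA hZ⟩
  rw [Submodule.range_inclusion, LinearMap.ker_codRestrict, LinearMap.ker_comp, A.ker_mkQ]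

end SerreClasses

/-! ### The grading of the standard module and the layers of a submodule. -/

section Layers

variable {V : Type*} [AddCommGroup V] [Module ℂ V] {G : Subgroup (V ≃ₗ[ℂ] V)} [Finite G]
  (c : Param G) {W : Type*} [AddCommGroup W] [Module ℂ W] (ρ : Representation ℂ G W)

/-- The action of `G` on `Δ_c(W)`. -/
def stdRep : Representation ℂ G (Standard c ρ) :=
  (Algebra.lsmul ℂ ℂ (Standard c ρ)).toMonoidHom.comp (groupHom c)

theorem stdRep_apply (g : G) (m : Standard c ρ) : stdRep c ρ g m = groupElt c g • m := rfl

/-- The part of degree `d` of `Δ_c(W)`. -/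
def stdHomog (d : ℕ) : Submodule ℂ (Standard c ρ) := Submodule.map₂ (vec c ρ) (homog V d) ⊤

theorem vec_mem_stdHomog {d : ℕ} {f : Poly V} (hf : f ∈ homog V d) (u : W) :
    vec c ρ f u ∈ stdHomog c ρ d :=
  Submodule.apply_mem_map₂ _ hf trivial

theorem stdHomog_induction {d : ℕ} {motive : (m : Standard c ρ) → m ∈ stdHomog c ρ d → Prop}
    (vec : ∀ f, ∀ hf : f ∈ homog V d, ∀ u, motive (vec c ρ f u) (vec_mem_stdHomog c ρ hf u))
    (add : ∀ m n hm hn, motive m hm → motive n hn → motive (m + n) (add_mem hm hn))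
    {m : Standard c ρ} (hm : m ∈ stdHomog c ρ d) : motive m hm := by
  -- Quantifying over multiples absorbs the scalar case of span induction, since a multiple of `f ⊗
  -- u` is again of this form.
  suffices ∀ z : ℂ, ∃ h : z • m ∈ stdHomog c ρ d, motive (z • m) h by
    obtain ⟨h, h'⟩ := this 1
    simpa using h'
  rw [stdHomog, Submodule.map₂_eq_span_image2] at hm
  induction hm using Submodule.span_induction with
  | mem m hm =>
    intro z
    obtain ⟨f, hf, u, -, rfl⟩ := hm
    rw [← LinearMap.smul_apply, ← map_smul]
    exact ⟨_, vec _ (Submodule.smul_mem _ z hf) u⟩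
  | zero =>
    intro z
    have := vec 0 (zero_mem _) 0
    simp only [map_zero] at this
    rw [smul_zero]
    exact ⟨_, this⟩
  | add m n _ _ hm hn =>
    intro z
    obtain ⟨h1, h1'⟩ := hm z
    obtain ⟨h2, h2'⟩ := hn z
    rw [smul_add]
    exact ⟨_, add _ _ h1 h2 h1' h2'⟩
  | smul z m _ hm =>
    intro z'
    rw [smul_smul]
    exact hm (z' * z)

theorem exists_eq_vec_one {m : Standard c ρ} (hm : m ∈ stdHomog c ρ 0) :
    ∃ u, m = vec c ρ 1 u := by
  induction hm using stdHomog_induction with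
  | vec f hf u =>
    obtain ⟨z, rfl⟩ := mem_homog_zero.1 hf
    exact ⟨z • u, by rw [Algebra.algebraMap_eq_smul_one]; simp⟩
  | add m n _ _ hm hn =>
    obtain ⟨u, rfl⟩ := hm
    obtain ⟨u', rfl⟩ := hn
    exact ⟨u + u', by rw [map_add]⟩

theorem groupElt_smul_mem_stdHomog (g : G) {d : ℕ} {m : Standard c ρ}
    (hm : m ∈ stdHomog c ρ d) : groupElt c g • m ∈ stdHomog c ρ d := by
  induction hm using stdHomog_induction with
  | vec f hf u =>
    rw [groupElt_smul_vec]
    exact vec_mem_stdHomog c ρ (polyAct_mem_homog _ hf) _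
  | add m n _ _ hm hn =>
    rw [smul_add]
    exact add_mem hm hn

theorem dunklElt_smul_mem_stdHomog (y : V) {d : ℕ} {m : Standard c ρ}
    (hm : m ∈ stdHomog c ρ (d + 1)) : dunklElt c y • m ∈ stdHomog c ρ d := by
  induction hm using stdHomog_induction with
  | vec f hf u =>
    rw [dunklElt_smul_vec]
    exact sub_mem (vec_mem_stdHomog c ρ (pderiv_mem_homog y hf) _)
      (sum_mem fun r _ => Submodule.smul_mem _ _
        (vec_mem_stdHomog c ρ (divDiff_mem_homog r hf) _))
  | add m n _ _ hm hn =>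
    rw [smul_add]
    exact add_mem hm hn

variable (N : Submodule (RCA c) (Standard c ρ))

/-- The part of degree `d` of a submodule of `Δ_c(W)`. -/
def layer (d : ℕ) : Submodule ℂ (Standard c ρ) := N.restrictScalars ℂ ⊓ stdHomog c ρ d

/-- The span of the products of linear forms with elements of degree `d` of a submodule. -/
def decomposable (d : ℕ) : Submodule ℂ (Standard c ρ) :=
  Submodule.span ℂ {m | ∃ x : Module.Dual ℂ V, ∃ n ∈ layer c ρ N d, m = mulElt c (coord x) • n}

section

variable {c ρ N}

theorem stdRep_mem_layer {d : ℕ} (g : G) :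
    layer c ρ N d ≤ (layer c ρ N d).comap (stdRep c ρ g) :=
  fun _ hm => ⟨N.smul_mem _ hm.1, groupElt_smul_mem_stdHomog c ρ g hm.2⟩

theorem stdRep_mem_decomposable {d : ℕ} (g : G) :
    decomposable c ρ N d ≤ (decomposable c ρ N d).comap (stdRep c ρ g) := by
  rw [decomposable, Submodule.span_le]
  rintro _ ⟨x, n, hn, rfl⟩
  refine Submodule.subset_span ⟨x ∘ₗ ((g : V ≃ₗ[ℂ] V)⁻¹ : V ≃ₗ[ℂ] V).toLinearMap,
    stdRep c ρ g n, stdRep_mem_layer g hn, ?_⟩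
  rw [stdRep_apply, stdRep_apply, smul_smul, groupElt_mul_mulElt, mul_smul, polyAct_coord]

/-- The `u` with `1 ⊗ u ∈ N` form a subrepresentation; if it were everything, `N` would contain
generators of the whole module. -/
theorem layer_zero (hρ : ρ.IsIrreducible) (hN : N ≠ ⊤) : layer c ρ N 0 = ⊥ := by
  rw [eq_bot_iff]
  intro m hm
  obtain ⟨u, rfl⟩ := exists_eq_vec_one c ρ hm.2
  let S : Subrepresentation ρ :=
    ⟨(N.restrictScalars ℂ).comap (vec c ρ 1), fun g u hu => by
      rw [Submodule.mem_comap, ← groupElt_smul_vec_one]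
      exact N.smul_mem _ hu⟩
  rcases hρ.eq_bot_or_eq_top S with h | h
  · have : u ∈ S.toSubmodule := hm.1
    rw [h] at this
    rw [(Submodule.mem_bot ℂ).1 this, map_zero]
    exact zero_mem _
  · refine absurd (submodule_eq_top_of_vec_one c ρ fun u => ?_) hN
    have : u ∈ S.toSubmodule := by
      rw [h]
      exact Submodule.mem_top
    exact this

end

variable [FiniteDimensional ℂ V]

theorem stdHomog_finite [FiniteDimensional ℂ W] (d : ℕ) :
    FiniteDimensional ℂ (stdHomog c ρ d) :=
  Module.Finite.iff_fg.2 ((homog_finite d).map₂ _ Module.Finite.fg_top)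

theorem eulerElt_smul {κ : ℂ} (hκ : reflSum c ρ = κ • 1) {d : ℕ} {m : Standard c ρ}
    (hm : m ∈ stdHomog c ρ d) : eulerElt c • m = (κ + d) • m := by
  induction hm using stdHomog_induction with
  | vec f hf u => rw [eulerElt_smul_vec c ρ hf, hκ, LinearMap.smul_apply, map_smul, add_smul]; rfl
  | add m n _ _ hm hn => rw [smul_add, hm, hn, smul_add]

theorem evalStd_groupElt_smul {v : V} {g : G} (hg : (g : V ≃ₗ[ℂ] V) v = v) {d : ℕ}
    {m : Standard c ρ} (hm : m ∈ stdHomog c ρ d) :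
    evalStd c ρ v (groupElt c g • m) = ρ g (evalStd c ρ v m) := by
  induction hm using stdHomog_induction with
  | vec f hf u =>
    have hg' : (g : V ≃ₗ[ℂ] V)⁻¹ v = v :=
      ((g : V ≃ₗ[ℂ] V).symm_apply_eq).2 hg.symm
    rw [groupElt_smul_vec, evalStd_vec, evalStd_vec, polyEval_polyAct, hg', map_smul]
  | add m n _ _ hm hn => rw [smul_add, map_add, hm, hn, map_add, map_add]

theorem evalStd_mulElt_smul (v : V) (f : Poly V) {d : ℕ} {m : Standard c ρ}
    (hm : m ∈ stdHomog c ρ d) :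
    evalStd c ρ v (mulElt c f • m) = polyEval v f • evalStd c ρ v m := by
  induction hm using stdHomog_induction with
  | vec h hh u => rw [mulElt_smul_vec, evalStd_vec, evalStd_vec, map_mul, mul_smul]
  | add m n _ _ hm hn => rw [smul_add, map_add, hm, hn, map_add, smul_add]

variable {c ρ N}

/-- The difference is minus `∑ x_i y_i m`, and each `y_i m` lies in the layer below. -/
theorem reflSum_sub_mem_decomposable {κ : ℂ} (hκ : reflSum c ρ = κ • 1) {d : ℕ}
    {m : Standard c ρ} (hm : m ∈ layer c ρ N (d + 1)) :
    reflSum c (stdRep c ρ) m - (κ + (d + 1 : ℕ)) • m ∈ decomposable c ρ N d := by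
  have h1 : eulerElt c • m = ∑ i, mulElt c (coord ((Module.finBasis ℂ V).coord i)) •
      dunklElt c (Module.finBasis ℂ V i) • m + reflSum c (stdRep c ρ) m := by
    simp only [eulerElt, add_smul, Finset.sum_smul, mul_smul, reflSum, LinearMap.sum_apply,
      LinearMap.smul_apply, LinearMap.sub_apply, Module.End.one_apply, stdRep_apply, smul_assoc,
      sub_smul, one_smul]
  rw [← eulerElt_smul c ρ hκ hm.2, h1, sub_add_cancel_right]
  refine neg_mem (sum_mem fun i _ => Submodule.subset_span ⟨_, _, ⟨N.smul_mem _ hm.1, ?_⟩, rfl⟩)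
  exact dunklElt_smul_mem_stdHomog c ρ _ hm.2

theorem evalStd_decomposable_le (v : V) (d : ℕ) :
    decomposable c ρ N d ≤ ((layer c ρ N d).map (evalStd c ρ v)).comap (evalStd c ρ v) := by
  rw [decomposable, Submodule.span_le]
  rintro _ ⟨x, n, hn, rfl⟩
  rw [SetLike.mem_coe, Submodule.mem_comap, evalStd_mulElt_smul c ρ v _ hn.2]
  exact Submodule.smul_mem _ _ ⟨n, hn, rfl⟩

theorem exists_map_layer_eq_top {κ : ℂ} (hκ : reflSum c ρ = κ • 1)
    (hN : FiniteDimensional ℂ (Standard c ρ ⧸ N)) {v : V} (hv : v ≠ 0) :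
    ∃ d, (layer c ρ N d).map (evalStd c ρ v) = ⊤ := by
  let φ : Module.End ℂ (Standard c ρ ⧸ N) := Algebra.lsmul ℂ ℂ _ (eulerElt c)
  -- An operator on a finite dimensional space has finitely many eigenvalues, while the `κ + d` are
  -- infinitely many.
  obtain ⟨d, hd⟩ : ∃ d : ℕ, ¬ φ.HasEigenvalue (κ + d) := by
    by_contra! h
    have hinj : Function.Injective fun d : ℕ => κ + (d : ℂ) :=
      (add_right_injective κ).comp Nat.cast_injective
    exact Set.infinite_range_of_injective hinj
      ((Module.End.finite_hasEigenvalue φ).subset (Set.range_subset_iff.2 h))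
  obtain ⟨x, hx⟩ : ∃ x : Module.Dual ℂ V, x v ≠ 0 := by
    by_contra! h
    exact hv ((Module.forall_dual_apply_eq_zero_iff ℂ v).1 h)
  refine ⟨d, eq_top_iff.2 fun u _ => ?_⟩
  have hmem := vec_mem_stdHomog c ρ (coord_pow_mem_homog x d) ((x v ^ d)⁻¹ • u)
  -- This element has value `u` at `v`. Its class modulo `N` would be an eigenvector for `κ + d`, so
  -- it lies in `N`.
  refine ⟨vec c ρ (coord x ^ d) ((x v ^ d)⁻¹ • u), ⟨?_, hmem⟩, ?_⟩
  · have h1 : N.mkQ (vec c ρ (coord x ^ d) ((x v ^ d)⁻¹ • u)) ∈ φ.eigenspace (κ + d) := by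
      rw [Module.End.mem_eigenspace_iff]
      exact congrArg N.mkQ (eulerElt_smul c ρ hκ hmem)
    by_contra h2
    exact hd (Module.End.hasEigenvalue_of_hasEigenvector
      ⟨h1, fun h => h2 ((Submodule.Quotient.mk_eq_zero N).1 h)⟩)
  · rw [evalStd_vec, map_pow, polyEval_coord, smul_inv_smul₀ (pow_ne_zero d hx)]

end Layers

/-! ### The values of a submodule at `v`, layer by layer. -/

section Fibre

variable {V : Type*} [AddCommGroup V] [Module ℂ V] [FiniteDimensional ℂ V]
  {G : Subgroup (V ≃ₗ[ℂ] V)} [Finite G] {c : Param G} {v : V}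
  {P : ObjectProperty (FDRep ℂ (MulAction.stabilizer G v))} [P.IsSerreClass]

/-- The values at `v` of the elements of degree at most `d` of a proper submodule of `Δ_c(W)`
lie in a subrepresentation that belongs to `P`. -/
theorem exists_inClass {W : Type} [AddCommGroup W] [Module ℂ W] [FiniteDimensional ℂ W]
    (ρ : Representation ℂ G W) (hρ : ρ.IsIrreducible)
    (hP : ∀ (T : FDRep ℂ G) (hT : Representation.IsIrreducible T.ρ),
      (∃ n : ℕ, 0 < n ∧ cValue c T.ρ hT - cValue c ρ hρ = n) →
        P (res (MulAction.stabilizer G v) T))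
    {N : Submodule (RCA c) (Standard c ρ)} (hN : N ≠ ⊤) (d : ℕ) :
    ∃ A : Submodule ℂ W, InClass P (ρ.comp (MulAction.stabilizer G v).subtype) A ∧
      ∀ e ≤ d, (layer c ρ N e).map (evalStd c ρ v) ≤ A := by
  induction d with
  | zero =>
    refine ⟨⊥, ⟨fun h => bot_le, prop_of_subsingleton _⟩, fun e he => ?_⟩
    rw [Nat.le_zero.1 he, layer_zero hρ hN, Submodule.map_bot]
  | succ d ih =>
    obtain ⟨A, hA, hle⟩ := ih
    have hκ := cValue_spec c ρ hρ
    set κ := cValue c ρ hρ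
    set L := layer c ρ N (d + 1) with hL
    have : FiniteDimensional ℂ L :=
      have := stdHomog_finite c ρ (d + 1)
      Submodule.finiteDimensional_of_le inf_le_right
    let D : Submodule ℂ L := (decomposable c ρ N d).comap L.subtype
    let σ := (stdRep c ρ).subrepresentation L stdRep_mem_layer
    have hD : ∀ g, D ≤ D.comap (σ g) := fun g m hm => stdRep_mem_decomposable g hm
    let ev : L →ₗ[ℂ] W ⧸ A := A.mkQ ∘ₗ evalStd c ρ v ∘ₗ L.subtype
    -- Decomposable elements take values already attained in degree `d`, so evaluation modulo `A`
    -- factors through `L / D`.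
    have hev : D ≤ LinearMap.ker ev := by
      intro m hm
      rw [LinearMap.mem_ker]
      exact (Submodule.Quotient.mk_eq_zero A).2
        (hle d le_rfl (evalStd_decomposable_le v d hm))
    have hτ : ∀ t, reflSum c (σ.quotient D hD) t = (κ + (d + 1 : ℕ)) • t := by
      intro t
      obtain ⟨m, rfl⟩ := D.mkQ_surjective t
      rw [← map_reflSum c σ (σ.quotient D hD) D.mkQ (fun _ _ => rfl), ← map_smul, ← sub_eq_zero,
        ← map_sub]
      refine (Submodule.Quotient.mk_eq_zero D).2 ?_
      have h := reflSum_sub_mem_decomposable hκ m.2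
      rw [← L.subtype_apply, ← map_reflSum c σ (stdRep c ρ) L.subtype (fun _ _ => rfl)] at h
      exact h
    -- Scalar `κ + d + 1` means `c_μ - c_λ = d + 1`, a positive integer, which is where the
    -- hypothesis on `P` enters.
    have hA' := inClass_comap_mkQ c (κ := κ + (d + 1 : ℕ)) (fun T hT h =>
      hP T hT ⟨d + 1, d.succ_pos, by rw [h, add_sub_cancel_left]⟩)
      (σ.quotient D hD) hτ hA (D.liftQ ev hev) (by
        intro h t x htx
        obtain ⟨m, rfl⟩ := D.mkQ_surjective t
        have h1 : evalStd c ρ v m.1 - x ∈ A := (Submodule.Quotient.eq A).1 htx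
        have h2 := hA.1 h h1
        refine (Submodule.Quotient.eq A).2 ?_
        have h3 : evalStd c ρ v (groupElt c h.1 • m.1) = ρ h.1 (evalStd c ρ v m.1) :=
          evalStd_groupElt_smul c ρ h.2 m.2.2
        change evalStd c ρ v (groupElt c h.1 • m.1) - ρ h.1 x ∈ A
        rw [h3, ← map_sub]
        exact h2)
    refine ⟨_, hA', fun e he => ?_⟩
    rcases Nat.le_succ_iff.1 he with he | rfl
    · refine (hle e he).trans fun x hx => ⟨0, ?_⟩
      rw [map_zero]
      exact ((Submodule.Quotient.mk_eq_zero A).2 hx).symm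
    · rintro _ ⟨m, hm, rfl⟩
      exact ⟨D.mkQ ⟨m, hm⟩, rfl⟩

end Fibre

end Cherednik

end

theorem mainTheorem2 {V : Type*} [AddCommGroup V] [Module ℂ V] [FiniteDimensional ℂ V]
    (G : Subgroup (V ≃ₗ[ℂ] V)) [Finite G] (c : Cherednik.Param G)
    (S : FDRep ℂ G) (hS : Representation.IsIrreducible S.ρ)
    (hL : FiniteDimensional ℂ (Cherednik.Irred c S.ρ)) (v : V) (hv : v ≠ 0) :
    Cherednik.serreClosure
      (fun X : FDRep ℂ (MulAction.stabilizer G v) =>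
        ∃ (T : FDRep ℂ G) (hT : Representation.IsIrreducible T.ρ),
          (∃ n : ℕ, 0 < n ∧ Cherednik.cValue c T.ρ hT - Cherednik.cValue c S.ρ hS = n) ∧
          X = Cherednik.res (MulAction.stabilizer G v) T)
      (Cherednik.res (MulAction.stabilizer G v) S) := by
  intro P _ hQ
  have := Cherednik.nontrivial_of_isIrreducible hS
  obtain ⟨d, hd⟩ := Cherednik.exists_map_layer_eq_top (Cherednik.cValue_spec c S.ρ hS) hL hv
  obtain ⟨A, ⟨hA, hPA⟩, hle⟩ := Cherednik.exists_inClass S.ρ hS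
    (fun T hT h => hQ _ ⟨T, hT, h, rfl⟩) (Cherednik.jacobson_ne_top c S.ρ) d
  -- Layer `d` takes all values at `v`, so the subrepresentation `A` is the whole of `S`.
  refine Cherednik.prop_of_surjective (Y := Cherednik.res (MulAction.stabilizer G v) S)
    A.subtype (fun _ _ => rfl) (fun x => ?_) hPA
  exact ⟨⟨x, hle d le_rfl (hd ▸ Submodule.mem_top)⟩, rfl⟩
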